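/- Let $A$ be a finite ordered set of $n\ge 1$ agents and let $G=(A,E)$ be a directed graph without loops; $(x,y)\in E$ means that $x$ confirms $y$. The agents vote one after another, openly, in the given order. In plurality voting each agent votes for at most one other agent; in approval voting each agent votes for any set of other agents; abstention is allowed in both. The agent with the most votes is elected, ties being broken in favour of the agent who comes first in the order. If $y$ is elected, agent $x$ receives $\mathcal U_x(y)+\mathcal B_x$, where $\mathcal U_x(y)=1$ if $y=x$, $\mathcal U_x(y)=\tfrac12$ if $(x,y)\in E$, and $\mathcal U_x(y)=0$ otherwise, and $\mathcal B_x=\varepsilon^2 f(x)-\varepsilon g(x)$, where $f(x)$ (resp. $g(x)$) is the number of agents that $x$ votes for and confirms (resp. does not confirm), and $0<\varepsilon<\frac1{2n}$. An agent is achievable if he is elected in some subgame perfect equilibrium (SPE); $W$ is the set of achievable agents. Let $d(a)$ be the in-degree (popularity) of $a$, and $\Delta_{in}(G)$, $\Delta_{out}(G)$ the maximum in- and out-degree. For $w\in W$ let $\mathcal D(w)=\Delta_{in}(G_{-E_w})-d(w)$, where $G_{-E_w}$ is $G$ without the out-edges of $w$, and let $\mathcal D(G)=\min_{w\in W}\mathcal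 D(w)$. Then, for plurality voting and for approval voting alike, the additive gap $\mathcal D=\sup_G\mathcal D(G)$ over the class of graphs with maximum out-degree two is unbounded, i.e. $\mathcal D=\infty$ (whatever admissible $\varepsilon=\varepsilon_n$ is used for graphs on $n$ agents). More precisely, for each of the two voting rules and for every integer $k\ge2$ there is a graph $G$ with $\Delta_{out}(G)=2$ and an agent $w$ of popularity $d(w)=\Delta_{in}(G)-k$ such that, for every $0<\varepsilon<\frac1{2n}$, $w$ is the unique achievable agent and $\mathcal D(G)=k$. -/

import Mathlib

namespace SeqVoting

/-- A confirmation network on `n` agents. The agents are `0, 1, …, n - 1`; their order is both the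
voting order and the tie-breaking order. `out x` is the set of agents that `x` confirms
(the out-neighbours of `x`); agents only confirm other agents. -/
structure Network (n : ℕ) where
  out : Fin n → Finset (Fin n)
  not_mem_self : ∀ x, x ∉ out x

inductive VotingRule where
  | plurality
  | approval

/-- A ballot is the set of agents voted for; the empty set is abstention. -/
abbrev Ballot (n : ℕ) := Finset (Fin n)

/-- The ballots that agent `x` may cast: in plurality voting at most one other agent,
in approval voting any set of other agents. -/
def VotingRule.Legal {n : ℕ} : VotingRule → Fin n → Ballot n → Prop
  | .plurality, x, S => x ∉ S ∧ S.card ≤ 1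
  | .approval, x, S => x ∉ S

/-- A list of ballots, the `i`-th being the ballot of agent `i`, is a legal history if the agents
`0, …, h.length - 1` have voted so far and each has cast a legal ballot. -/
def VotingRule.LegalHistory {n : ℕ} (rule : VotingRule) (h : List (Ballot n)) : Prop :=
  h.length ≤ n ∧ ∀ (i : Fin n) (hi : (i : ℕ) < h.length), rule.Legal i h[i]

/-- A strategy profile: after a history `h` with `h.length < n`, the agent whose turn it is
(the agent number `h.length`) casts the ballot `σ h`. Its values at the histories of length `i`
form the strategy of agent `i`. -/
abbrev Profile (n : ℕ) := List (Ballot n) → Ballot n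

def VotingRule.LegalProfile {n : ℕ} (rule : VotingRule) (σ : Profile n) : Prop :=
  ∀ (h : List (Ballot n)) (hh : h.length < n), rule.LegalHistory h → rule.Legal ⟨h.length, hh⟩ (σ h)

/-- The history reached from `h` when the next `m` agents follow `σ`. -/
def Profile.steps {n : ℕ} (σ : Profile n) : ℕ → List (Ballot n) → List (Ballot n)
  | 0, h => h
  | m + 1, h => Profile.steps σ m (h ++ [σ h])

/-- The complete list of ballots when all the agents after `h` follow `σ`. -/
def Profile.complete {n : ℕ} (σ : Profile n) (h : List (Ballot n)) : List (Ballot n) :=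
  σ.steps (n - h.length) h

/-- The number of votes that `a` receives. -/
def score {n : ℕ} (L : List (Ballot n)) (a : Fin n) : ℕ :=
  L.countP (fun S => a ∈ S)

/-- `w` has the most votes, and comes first among those who have the most votes. -/
def IsWinner {n : ℕ} (L : List (Ballot n)) (w : Fin n) : Prop :=
  (∀ a, score L a ≤ score L w) ∧ ∀ a, score L a = score L w → w ≤ a

theorem existsUnique_isWinner {n : ℕ} (hn : 0 < n) (L : List (Ballot n)) : ∃! w, IsWinner L w := by
  classical
  have : Nonempty (Fin n) := ⟨⟨0, hn⟩⟩
  obtain ⟨m, hm⟩ := Finite.exists_max (score L)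
  let M := Finset.univ.filter (fun w => score L w = score L m)
  have hM : M.Nonempty := ⟨m, by simp [M]⟩
  have h1 : score L (M.min' hM) = score L m := by
    have := M.min'_mem hM
    simpa [M] using this
  refine ⟨M.min' hM, ⟨fun a => h1 ▸ hm a, fun a ha => M.min'_le a ?_⟩, fun w hw => ?_⟩
  · simp [M, ha, h1]
  · have h2 : score L w = score L m := le_antisymm (hm w) (hw.1 m)
    refine le_antisymm (hw.2 _ (h1.trans h2.symm)) (M.min'_le w ?_)
    simp [M, h2]

namespace Network

variable {n : ℕ}

/-- The utility of agent `x` when `y` is elected. -/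
noncomputable def utility (G : Network n) (x y : Fin n) : ℝ :=
  if y = x then 1 else if y ∈ G.out x then 1 / 2 else 0

/-- The truth-bias bonus of agent `x` for casting the ballot `S`. -/
noncomputable def bonus (G : Network n) (ε : ℝ) (x : Fin n) (S : Ballot n) : ℝ :=
  ε ^ 2 * ((S ∩ G.out x).card : ℝ) - ε * ((S \ G.out x).card : ℝ)

open Classical in
/-- The payoff of agent `x` when `L` is the complete list of ballots. The sum has exactly one
term, for the elected agent. -/
noncomputable def payoff (G : Network n) (ε : ℝ) (x : Fin n) (L : List (Ballot n)) : ℝ :=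
  (∑ y with IsWinner L y, G.utility x y) + G.bonus ε x (L.getD x ∅)

/-- Subgame perfect equilibrium: after every legal history, no agent can gain by changing only
his own strategy. -/
def IsSPE (G : Network n) (rule : VotingRule) (ε : ℝ) (σ : Profile n) : Prop :=
  rule.LegalProfile σ ∧
    ∀ h : List (Ballot n), rule.LegalHistory h →
      ∀ (x : Fin n) (τ : Profile n), rule.LegalProfile τ →
        (∀ h' : List (Ballot n), h'.length ≠ x → τ h' = σ h') →
          G.payoff ε x (τ.complete h) ≤ G.payoff ε x (σ.complete h)

/-- The set `W` of achievable agents: those elected in some subgame perfect equilibrium. -/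
def achievable (G : Network n) (rule : VotingRule) (ε : ℝ) : Set (Fin n) :=
  {w | ∃ σ : Profile n, G.IsSPE rule ε σ ∧ IsWinner (σ.complete []) w}

/-- The popularity (in-degree) of `a`. -/
def popularity (G : Network n) (a : Fin n) : ℕ :=
  (Finset.univ.filter (fun b => a ∈ G.out b)).card

/-- The maximum in-degree. -/
def maxIn (G : Network n) : ℕ := Finset.univ.sup G.popularity

/-- The maximum out-degree. -/
def maxOut (G : Network n) : ℕ := Finset.univ.sup (fun a => (G.out a).card)

/-- The network with all out-edges of `w` removed. -/
def removeOut (G : Network n) (w : Fin n) : Network n where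
  out x := if x = w then ∅ else G.out x
  not_mem_self x := by
    split_ifs
    · simp
    · exact G.not_mem_self x

/-- The additive gap of the agent `w`. -/
def agentGap (G : Network n) (w : Fin n) : ℤ :=
  ((G.removeOut w).maxIn : ℤ) - (G.popularity w : ℤ)

/-- The additive gap of the network: the least gap of an achievable agent. -/
noncomputable def additiveGap (G : Network n) (rule : VotingRule) (ε : ℝ) : ℤ :=
  sInf (G.agentGap '' G.achievable rule ε)

end Network

/-- The supremum of the additive gaps of the networks of a class `C`, where `ε n` is the
truth-bias parameter used for networks on `n` agents. -/
noncomputable def supAdditiveGap (rule : VotingRule) (ε : ℕ → ℝ)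
    (C : ∀ n : ℕ, Set (Network n)) : EReal :=
  ⨆ (n : ℕ) (G : Network n) (_ : G ∈ C n), (((G.additiveGap rule (ε n) : ℤ) : ℝ) : EReal)

end SeqVoting

/-!
For admissible `ε` a subgame perfect equilibrium is a profile in which every voter first maximises
the utility of the outcome, and only then prefers to cast many votes for agents he confirms and none
for other agents. A voter who gains nothing from the eventual outcome therefore votes sincerely.
Hence the potential of an agent, which is the number of votes he has received so far plus the number
of agents still to vote who confirm him, bounds the final score of the elected agent from above and,
up to the voters with a stake in his election, the final scores of his rivals from below.

Approval voting: `k` pairs of voters confirm the candidate `0` and, alternately, `1` and `2`.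
Plurality voting: `k` blocks of `k + 1` voters confirm the candidate `k + 1` and, in the block
number `i`, the candidate `i`. In both cases backward induction shows that the first vote for
anybody but the common candidate would elect somebody whom the voter does not confirm, so the common
candidate wins, although `1` respectively `0` is more popular by `k`.
-/

namespace SeqVoting

variable {n : ℕ}

/-! ### Histories and the elected agent -/

/-- The elected agent. -/
noncomputable def winner [NeZero n] (L : List (Ballot n)) : Fin n :=
  (existsUnique_isWinner (NeZero.pos n) L).choose

theorem isWinner_winner [NeZero n] (L : List (Ballot n)) : IsWinner L (winner L) :=
  (existsUnique_isWinner (NeZero.pos n) L).choose_spec.1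

theorem isWinner_iff [NeZero n] {L : List (Ballot n)} {w : Fin n} :
    IsWinner L w ↔ winner L = w :=
  ⟨(existsUnique_isWinner (NeZero.pos n) L).unique (isWinner_winner L),
    fun h => h ▸ isWinner_winner L⟩

theorem score_add_ite_lt_le_score_winner [NeZero n] (L : List (Ballot n)) (a : Fin n) :
    score L a + (if a < winner L then 1 else 0) ≤ score L (winner L) := by
  have hmax := (isWinner_winner L).1 a
  split_ifs with hlt
  · exact hmax.lt_of_ne fun h => ((isWinner_winner L).2 a h).not_gt hlt
  · exact hmax

@[simp]
theorem score_nil (a : Fin n) : score ([] : List (Ballot n)) a = 0 := rfl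

theorem score_append (h : List (Ballot n)) (B : Ballot n) (a : Fin n) :
    score (h ++ [B]) a = score h a + if a ∈ B then 1 else 0 := by
  simp [score, List.countP_append, List.countP_cons]

theorem score_replicate_singleton {n : ℕ} (t : ℕ) (a b : Fin n) :
    score (List.replicate t {a}) b = if b = a then t else 0 := by
  simp [score, List.countP_replicate]

theorem score_le_length (h : List (Ballot n)) (a : Fin n) : score h a ≤ h.length :=
  List.countP_le_length

namespace Profile

theorem length_steps (σ : Profile n) (m : ℕ) (h : List (Ballot n)) :
    (σ.steps m h).length = h.length + m := by
  induction m generalizing h with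
  | zero => rfl
  | succ m ih =>
    rw [steps, ih, List.length_append, List.length_singleton, add_right_comm, add_assoc]

theorem steps_add (σ : Profile n) (a b : ℕ) (h : List (Ballot n)) :
    σ.steps (a + b) h = σ.steps b (σ.steps a h) := by
  induction a generalizing h with
  | zero => rw [zero_add, steps]
  | succ a ih => rw [Nat.succ_add, steps, steps, ih]

theorem steps_getElem? (σ : Profile n) (m : ℕ) (h : List (Ballot n)) {i : ℕ} (hi : i < h.length) :
    (σ.steps m h)[i]? = h[i]? := by
  induction m generalizing h with
  | zero => rfl
  | succ m ih => rw [steps, ih _ (by simp; omega), List.getElem?_append_left hi]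

theorem score_le_score_steps (σ : Profile n) (m : ℕ) (h : List (Ballot n)) (a : Fin n) :
    score h a ≤ score (σ.steps m h) a := by
  induction m generalizing h with
  | zero => rfl
  | succ m ih => exact (Nat.le.intro (score_append h _ a).symm).trans (ih _)

theorem steps_congr {σ τ : Profile n} {m : ℕ} {h : List (Ballot n)}
    (hστ : ∀ h', h.length ≤ h'.length → h'.length < h.length + m → τ h' = σ h') :
    τ.steps m h = σ.steps m h := by
  induction m generalizing h with
  | zero => rfl
  | succ m ih =>
    rw [steps, steps, hστ h le_rfl (by omega)]
    exact ih fun h' h1 h2 => hστ h' (by simp at h1; omega) (by simp at h2; omega)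

theorem complete_steps (σ : Profile n) {h : List (Ballot n)} {m : ℕ} (hm : h.length + m ≤ n) :
    σ.complete (σ.steps m h) = σ.complete h := by
  rw [complete, complete, ← steps_add, length_steps]
  congr 1
  omega

theorem complete_append_self (σ : Profile n) {h : List (Ballot n)} (hh : h.length < n) :
    σ.complete (h ++ [σ h]) = σ.complete h :=
  σ.complete_steps (m := 1) hh

theorem complete_append_getD (σ : Profile n) (h : List (Ballot n)) (B : Ballot n) :
    (σ.complete (h ++ [B])).getD h.length ∅ = B := by
  rw [List.getD_eq_getElem?_getD, complete, steps_getElem? _ _ _ (by simp)]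
  simp

/-- The agent elected when all the agents after `h` follow `σ`. -/
noncomputable def outcome [NeZero n] (σ : Profile n) (h : List (Ballot n)) : Fin n :=
  winner (σ.complete h)

theorem outcome_steps [NeZero n] (σ : Profile n) {h : List (Ballot n)} {m : ℕ}
    (hm : h.length + m ≤ n) : σ.outcome (σ.steps m h) = σ.outcome h := by
  rw [outcome, σ.complete_steps hm, outcome]

theorem outcome_append_self [NeZero n] (σ : Profile n) {h : List (Ballot n)} (hh : h.length < n) :
    σ.outcome (h ++ [σ h]) = σ.outcome h :=
  σ.outcome_steps (m := 1) hh

end Profile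

namespace VotingRule

variable {rule : VotingRule} {h : List (Ballot n)} {x : Fin n}

theorem legal_empty (rule : VotingRule) (x : Fin n) : rule.Legal x ∅ := by
  cases rule <;> simp [Legal]

theorem legal_singleton (rule : VotingRule) {x a : Fin n} (hxa : x ≠ a) : rule.Legal x {a} := by
  cases rule <;> simp [Legal, hxa]

theorem Legal.notMem {B : Ballot n} (hB : rule.Legal x B) : x ∉ B := by
  cases rule
  · exact hB.1
  · exact hB

theorem legalHistory_nil (rule : VotingRule) : rule.LegalHistory ([] : List (Ballot n)) :=
  ⟨by simp, by simp⟩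

theorem LegalHistory.append (hl : rule.LegalHistory h) (hx : h.length = x) {B : Ballot n}
    (hB : rule.Legal x B) : rule.LegalHistory (h ++ [B]) := by
  refine ⟨by simp; omega, fun i hi => ?_⟩
  rw [List.length_append, List.length_singleton] at hi
  rcases Nat.lt_succ_iff_lt_or_eq.mp hi with hlt | heq
  · have hget : (h ++ [B])[(i : ℕ)] = h[(i : ℕ)] := List.getElem_append_left hlt
    exact hget ▸ hl.2 i hlt
  · obtain rfl : i = x := Fin.ext (heq.trans hx)
    simpa [← hx] using hB

theorem LegalProfile.legal {σ : Profile n} (hσ : rule.LegalProfile σ) (hl : rule.LegalHistory h)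
    (hx : h.length = x) : rule.Legal x (σ h) := by
  have hh : h.length < n := hx ▸ x.2
  obtain rfl : x = ⟨h.length, hh⟩ := Fin.ext hx.symm
  exact hσ h hh hl

theorem LegalHistory.steps {σ : Profile n} (hl : rule.LegalHistory h) (hσ : rule.LegalProfile σ)
    {m : ℕ} (hm : h.length + m ≤ n) : rule.LegalHistory (σ.steps m h) := by
  induction m generalizing h with
  | zero => exact hl
  | succ m ih =>
    exact ih (hl.append (x := ⟨h.length, by omega⟩) rfl (hσ h _ hl)) (by simp; omega)

end VotingRule

namespace Network

/-! ### Utilities and bonuses -/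

theorem payoff_eq [NeZero n] (G : Network n) (ε : ℝ) (x : Fin n) (L : List (Ballot n)) :
    G.payoff ε x L = G.utility x (winner L) + G.bonus ε x (L.getD x ∅) := by
  classical
  have : (Finset.univ.filter fun y => IsWinner L y) = {winner L} := by
    ext y; simp [isWinner_iff, eq_comm]
  simp [payoff, this]

/-- `x` gains nothing from the election of `v`. -/
def Uninterested (G : Network n) (x v : Fin n) : Prop := v ≠ x ∧ v ∉ G.out x

theorem utility_self (G : Network n) (x : Fin n) : G.utility x x = 1 := by simp [utility]

theorem ne_of_mem_out (G : Network n) {x y : Fin n} (h : y ∈ G.out x) : x ≠ y :=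
  fun e => G.not_mem_self x (e ▸ h)

theorem utility_of_mem (G : Network n) {x y : Fin n} (h : y ∈ G.out x) :
    G.utility x y = 1 / 2 := by
  simp [utility, (G.ne_of_mem_out h).symm, h]

theorem Uninterested.utility_eq {G : Network n} {x v : Fin n} (h : G.Uninterested x v) :
    G.utility x v = 0 := by
  simp [utility, h.1, h.2]

theorem utility_nonneg (G : Network n) (x y : Fin n) : 0 ≤ G.utility x y := by
  unfold utility; split_ifs <;> norm_num

theorem utility_cases (G : Network n) (x y : Fin n) :
    (y = x ∧ G.utility x y = 1) ∨ (y ∈ G.out x ∧ G.utility x y = 1 / 2) ∨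
      G.utility x y = 0 := by
  by_cases hyx : y = x
  · exact Or.inl ⟨hyx, hyx ▸ G.utility_self x⟩
  by_cases hy : y ∈ G.out x
  · exact Or.inr (Or.inl ⟨hy, G.utility_of_mem hy⟩)
  · exact Or.inr (Or.inr (Uninterested.utility_eq ⟨hyx, hy⟩))

section Bonus

variable (G : Network n) {ε : ℝ} (hε : 0 < ε) (hεn : ε < 1 / (2 * (n : ℝ))) {x : Fin n}
  {B S : Ballot n}

include hεn in
theorem mul_card_lt_half (x : Fin n) : ε * n < 1 / 2 := by
  have : (0 : ℝ) < n := by exact_mod_cast x.pos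
  rw [lt_div_iff₀ (by positivity)] at hεn
  linarith

include hε in
theorem bonus_le_mul_card : G.bonus ε x B ≤ ε ^ 2 * ((B ∩ G.out x).card : ℝ) :=
  sub_le_self _ (by positivity)

include hε hεn in
theorem subset_out_of_bonus_le (hB : B ⊆ G.out x) (h : G.bonus ε x B ≤ G.bonus ε x S) :
    S ⊆ G.out x ∧ B.card ≤ S.card := by
  have hBonus : G.bonus ε x B = ε ^ 2 * (B.card : ℝ) := by
    simp [bonus, Finset.inter_eq_left.mpr hB, Finset.sdiff_eq_empty_iff_subset.mpr hB]
  rw [hBonus] at h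
  have hS : S ⊆ G.out x := by
    rw [← Finset.sdiff_eq_empty_iff_subset, ← Finset.card_eq_zero]
    by_contra h0
    have h1 : (1 : ℝ) ≤ ((S \ G.out x).card : ℝ) := by
      exact_mod_cast Nat.one_le_iff_ne_zero.mpr h0
    have h2 : ((S ∩ G.out x).card : ℝ) ≤ n := by
      exact_mod_cast (Finset.card_le_univ _).trans_eq (Fintype.card_fin n)
    have h3 : ε * ((S ∩ G.out x).card : ℝ) < 1 :=
      ((mul_le_mul_of_nonneg_left h2 hε.le).trans_lt (mul_card_lt_half hεn x)).trans (by norm_num)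
    have h4 : (0 : ℝ) ≤ ε ^ 2 * (B.card : ℝ) := by positivity
    unfold bonus at h
    nlinarith
  refine ⟨hS, ?_⟩
  have := h.trans (G.bonus_le_mul_card hε)
  rw [Finset.inter_eq_left.mpr hS] at this
  exact_mod_cast le_of_mul_le_mul_left this (by positivity)

include hε hεn in
theorem bonus_sub_bonus_lt : G.bonus ε x S - G.bonus ε x B < 1 / 2 := by
  have hcard : ((S ∩ G.out x).card : ℝ) + ((B \ G.out x).card : ℝ) ≤ n := by
    have hdisj : Disjoint (S ∩ G.out x) (B \ G.out x) :=
      Finset.disjoint_sdiff.mono_left Finset.inter_subset_right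
    rw [← Nat.cast_add, ← Finset.card_union_of_disjoint hdisj]
    exact_mod_cast (Finset.card_le_univ _).trans_eq (Fintype.card_fin n)
  have hlt := mul_card_lt_half hεn x
  have hn : (1 : ℝ) ≤ n := by exact_mod_cast x.pos
  have hS := G.bonus_le_mul_card (x := x) (B := S) hε
  have hB' : -(ε * ((B \ G.out x).card : ℝ)) ≤ G.bonus ε x B := by
    unfold bonus
    have : (0 : ℝ) ≤ ε ^ 2 * ((B ∩ G.out x).card : ℝ) := by positivity
    linarith
  have hsq : ε ^ 2 * ((S ∩ G.out x).card : ℝ) ≤ ε * ((S ∩ G.out x).card : ℝ) := by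
    gcongr
    nlinarith
  nlinarith

end Bonus

/-! ### Potentials -/

section Potential

variable (G : Network n)

/-- The number of agents from `t` on that confirm `a`. -/
def likersFrom (t : ℕ) (a : Fin n) : ℕ :=
  (Finset.univ.filter fun x : Fin n => t ≤ x ∧ a ∈ G.out x).card

theorem likersFrom_zero (a : Fin n) : G.likersFrom 0 a = G.popularity a := by
  simp [likersFrom, popularity]

theorem likersFrom_self (a : Fin n) : G.likersFrom n a = 0 := by
  rw [likersFrom, Finset.card_eq_zero, Finset.filter_eq_empty_iff]
  intro x _ hx
  omega

theorem likersFrom_eq_add (x a : Fin n) :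
    G.likersFrom x a = G.likersFrom (x + 1) a + if a ∈ G.out x then 1 else 0 := by
  have hsplit : (Finset.univ.filter fun y : Fin n => (x : ℕ) ≤ y ∧ a ∈ G.out y) =
      (Finset.univ.filter fun y : Fin n => (x : ℕ) + 1 ≤ y ∧ a ∈ G.out y) ∪
        if a ∈ G.out x then {x} else ∅ := by
    ext y
    have hxy : (x : ℕ) ≤ y ↔ (x : ℕ) + 1 ≤ y ∨ y = x := by rw [Fin.ext_iff]; omega
    split_ifs <;> grind
  rw [likersFrom, hsplit, Finset.card_union_of_disjoint, likersFrom]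
  · split_ifs <;> rfl
  · split_ifs <;> simp

/-- The number of votes that `a` gets if the agents after `h` vote for those they confirm. -/
def potential (h : List (Ballot n)) (a : Fin n) : ℕ :=
  score h a + G.likersFrom h.length a

variable {G} {h : List (Ballot n)} {x : Fin n}

theorem potential_append (hx : h.length = x) (B : Ballot n) (a : Fin n) :
    G.potential (h ++ [B]) a + (if a ∈ G.out x then 1 else 0) =
      G.potential h a + if a ∈ B then 1 else 0 := by
  have := G.likersFrom_eq_add x a
  rw [potential, potential, score_append, List.length_append, List.length_singleton, hx]
  omega

end Potential

/-! ### Existence of subgame perfect equilibria -/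

section Existence

variable (G : Network n) (rule : VotingRule) (ε : ℝ)

theorem exists_legal_forall_le (x : Fin n) (f : Ballot n → ℝ) :
    ∃ B, rule.Legal x B ∧ ∀ B', rule.Legal x B' → f B' ≤ f B := by
  classical
  obtain ⟨B, hB, hmax⟩ := Finset.exists_max_image (Finset.univ.filter fun B => rule.Legal x B) f
    ⟨∅, by simp [VotingRule.legal_empty]⟩
  exact ⟨B, by simpa using hB, fun B' hB' => hmax B' (by simpa using hB')⟩

/-- The ballots cast after `h` when the `m` remaining agents vote by backward induction. -/
noncomputable def optimalPlay : ℕ → List (Ballot n) → List (Ballot n)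
  | 0, h => h
  | m + 1, h => optimalPlay m (h ++ [if hh : h.length < n then
      (exists_legal_forall_le rule ⟨h.length, hh⟩ fun B =>
        G.payoff ε ⟨h.length, hh⟩ (optimalPlay m (h ++ [B]))).choose else ∅])

/-- The profile obtained by backward induction. -/
noncomputable def optimalProfile : Profile n := fun h =>
  if hh : h.length < n then
    (exists_legal_forall_le rule ⟨h.length, hh⟩ fun B =>
      G.payoff ε ⟨h.length, hh⟩ (optimalPlay G rule ε (n - (h.length + 1)) (h ++ [B]))).choose
  else ∅

theorem steps_optimalProfile (m : ℕ) (h : List (Ballot n)) (hm : h.length + m = n) :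
    (optimalProfile G rule ε).steps m h = optimalPlay G rule ε m h := by
  induction m generalizing h with
  | zero => rfl
  | succ m ih =>
    have : n - (h.length + 1) = m := by omega
    rw [Profile.steps, ih _ (by simp; omega), optimalPlay]
    simp only [optimalProfile, this]

theorem optimalProfile_spec {h : List (Ballot n)} (hh : h.length < n) :
    rule.Legal ⟨h.length, hh⟩ (optimalProfile G rule ε h) ∧
    ∀ B, rule.Legal ⟨h.length, hh⟩ B →
      G.payoff ε ⟨h.length, hh⟩ ((optimalProfile G rule ε).complete (h ++ [B])) ≤
      G.payoff ε ⟨h.length, hh⟩ ((optimalProfile G rule ε).complete h) := by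
  have hcomplete : ∀ B, (optimalProfile G rule ε).complete (h ++ [B]) =
      optimalPlay G rule ε (n - (h.length + 1)) (h ++ [B]) := fun B => by
    rw [Profile.complete, List.length_append, List.length_singleton,
      steps_optimalProfile _ _ _ _ _ (by simp; omega)]
  rw [← Profile.complete_append_self _ hh]
  simp only [hcomplete]
  simpa only [optimalProfile, hh, dif_pos] using
    (exists_legal_forall_le rule ⟨h.length, hh⟩ fun B => G.payoff ε ⟨h.length, hh⟩
      (optimalPlay G rule ε (n - (h.length + 1)) (h ++ [B]))).choose_spec

theorem isSPE_optimalProfile : G.IsSPE rule ε (optimalProfile G rule ε) := by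
  have hleg : rule.LegalProfile (optimalProfile G rule ε) := fun h hh _ =>
    (optimalProfile_spec G rule ε hh).1
  refine ⟨hleg, fun h hl x τ hτ hne => ?_⟩
  set σ := optimalProfile G rule ε
  rcases lt_or_ge (x : ℕ) h.length with hx | hx
  · rw [show τ.complete h = σ.complete h from
      Profile.steps_congr fun h' hlen _ => hne h' (by omega)]
  obtain ⟨m, hm⟩ := Nat.exists_eq_add_of_le hx
  have hmn : h.length + m ≤ n := by omega
  have hsame : τ.steps m h = σ.steps m h :=
    Profile.steps_congr fun h' _ hlen => hne h' (by omega)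
  rw [← σ.complete_steps hmn, ← τ.complete_steps hmn, hsame]
  have hlen : (σ.steps m h).length = x := by rw [Profile.length_steps, hm]
  have hlg := hl.steps hleg hmn
  generalize σ.steps m h = g at hlen hlg ⊢
  have hg : g.length < n := by omega
  obtain rfl : x = ⟨g.length, hg⟩ := Fin.ext hlen.symm
  have hτg : τ.complete (g ++ [τ g]) = σ.complete (g ++ [τ g]) :=
    Profile.steps_congr fun h' hlen' _ => hne h' (by simp at hlen' ⊢; omega)
  rw [← τ.complete_append_self hg, hτg]
  exact (optimalProfile_spec G rule ε hg).2 _ (hτ g hg hlg)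

variable {G rule ε}

theorem removeOut_eq_self {w : Fin n} (hw : G.out w = ∅) : G.removeOut w = G := by
  obtain ⟨out, hout⟩ := G
  simp only [removeOut, mk.injEq]
  funext x
  split_ifs with hx
  · exact (hx ▸ hw).symm
  · rfl

theorem additiveGap_of_achievable_eq {w : Fin n} (hw : G.achievable rule ε = {w}) :
    G.additiveGap rule ε = G.agentGap w := by
  rw [additiveGap, hw, Set.image_singleton, csInf_singleton]

end Existence

/-! ### Properties of equilibria -/

/-- An agent who is uninterested in the outcome certainly votes for `a`: in plurality voting when
he confirms nobody else, in approval voting whenever he confirms `a`. -/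
def Committed (G : Network n) : VotingRule → Fin n → Fin n → Prop
  | .plurality, x, a => G.out x = {a}
  | .approval, x, a => a ∈ G.out x

theorem Committed.mem_out {G : Network n} {rule : VotingRule} {x a : Fin n}
    (hc : G.Committed rule x a) : a ∈ G.out x := by
  cases rule
  · exact hc.symm ▸ Finset.mem_singleton_self a
  · exact hc

variable [NeZero n]

/-- A profile in which, after every legal history, the agent `x` whose turn it is cannot improve
the utility he gets from the outcome, and casts at least as many votes, all of them for agents he
confirms, as any legal ballot of that kind that does not lower this utility. This is all that
matters of a subgame perfect equilibrium, and it does not mention `ε`. -/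
structure IsTruthBiased (G : Network n) (rule : VotingRule) (σ : Profile n) : Prop where
  legal : rule.LegalProfile σ
  utility_le : ∀ {h : List (Ballot n)}, rule.LegalHistory h → ∀ {x : Fin n}, h.length = x →
    ∀ {B : Ballot n}, rule.Legal x B →
      G.utility x (σ.outcome (h ++ [B])) ≤ G.utility x (σ.outcome h)
  subset_out_of_utility_le : ∀ {h : List (Ballot n)}, rule.LegalHistory h →
    ∀ {x : Fin n}, h.length = x → ∀ {B : Ballot n}, rule.Legal x B → B ⊆ G.out x →
      G.utility x (σ.outcome h) ≤ G.utility x (σ.outcome (h ++ [B])) →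
        σ h ⊆ G.out x ∧ B.card ≤ (σ h).card

variable {G : Network n} {rule : VotingRule} {ε : ℝ} {σ : Profile n} {h : List (Ballot n)}
  {x v a w b : Fin n} {B : Ballot n}

theorem IsSPE.payoff_le (hσ : G.IsSPE rule ε σ) (hl : rule.LegalHistory h) (hx : h.length = x)
    (hB : rule.Legal x B) :
    G.utility x (σ.outcome (h ++ [B])) + G.bonus ε x B ≤
      G.utility x (σ.outcome h) + G.bonus ε x (σ h) := by
  have hh : h.length < n := hx ▸ x.2
  let τ : Profile n := Function.update σ h B
  have hτ_of_ne : ∀ {h'}, h' ≠ h → τ h' = σ h' := fun hne => Function.update_of_ne hne _ _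
  have hτ : rule.LegalProfile τ := by
    intro h' hh' hl'
    by_cases e : h' = h
    · subst e
      obtain rfl : x = ⟨h'.length, hh'⟩ := Fin.ext hx.symm
      simpa [τ] using hB
    · simpa only [hτ_of_ne e] using hσ.1 h' hh' hl'
  have hτh : τ.complete h = σ.complete (h ++ [B]) := by
    rw [← τ.complete_append_self hh, show τ h = B from Function.update_self _ _ _]
    exact Profile.steps_congr fun h' hlen _ => hτ_of_ne fun e => by simp [e] at hlen
  have key := hσ.2 h hl x τ hτ fun h' hne => hτ_of_ne fun e => hne (e ▸ hx)
  rwa [hτh, payoff_eq, payoff_eq, ← hx, σ.complete_append_getD, ← σ.complete_append_self hh,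
    σ.complete_append_getD, σ.complete_append_self hh] at key

theorem IsSPE.isTruthBiased (hσ : G.IsSPE rule ε σ) (hε : 0 < ε) (hεn : ε < 1 / (2 * (n : ℝ))) :
    G.IsTruthBiased rule σ where
  legal := hσ.1
  utility_le {h} hl {x} hx {B} hB := by
    have hpay := hσ.payoff_le hl hx hB
    have hbonus := G.bonus_sub_bonus_lt hε hεn (x := x) (B := B) (S := σ h)
    rcases G.utility_cases x (σ.outcome (h ++ [B])) with ⟨_, e⟩ | ⟨_, e⟩ | e <;>
    rcases G.utility_cases x (σ.outcome h) with ⟨_, e'⟩ | ⟨_, e'⟩ | e' <;>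
    linarith
  subset_out_of_utility_le {_} hl {x} hx {B} hB hsub hle :=
    G.subset_out_of_bonus_le hε hεn hsub (by linarith [hσ.payoff_le hl hx hB])

namespace IsTruthBiased

variable (hσ : G.IsTruthBiased rule σ) (hl : rule.LegalHistory h) (hx : h.length = x)

include hσ hl hx

theorem legalHistory_append_self : rule.LegalHistory (h ++ [σ h]) :=
  hl.append hx (hσ.legal.legal hl hx)

theorem outcome_eq_self (hB : rule.Legal x B) (ho : σ.outcome (h ++ [B]) = x) :
    σ.outcome h = x := by
  have hle := hσ.utility_le hl hx hB
  rw [ho, utility_self] at hle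
  rcases G.utility_cases x (σ.outcome h) with ⟨e, _⟩ | ⟨_, e⟩ | e
  · exact e
  all_goals norm_num [e] at hle

theorem outcome_mem_out (hB : rule.Legal x B) (ho : σ.outcome (h ++ [B]) ∈ G.out x)
    (hself : σ.outcome h ≠ x) : σ.outcome h ∈ G.out x := by
  have hle := hσ.utility_le hl hx hB
  rw [utility_of_mem _ ho] at hle
  rcases G.utility_cases x (σ.outcome h) with ⟨e, _⟩ | ⟨e, _⟩ | e
  · exact absurd e hself
  · exact e
  · norm_num [e] at hle

theorem outcome_ne_of_forall (hne : ∀ B, rule.Legal x B → σ.outcome (h ++ [B]) ≠ v) :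
    σ.outcome h ≠ v := by
  rw [← σ.outcome_append_self (hx ▸ x.2)]
  exact hne _ (hσ.legal.legal hl hx)

theorem subset_out_of_uninterested (hu : G.Uninterested x (σ.outcome h)) : σ h ⊆ G.out x :=
  (hσ.subset_out_of_utility_le hl hx (rule.legal_empty x) (by simp)
    (hu.utility_eq ▸ G.utility_nonneg _ _)).1

theorem outcome_eq_of_out_eq_pair (hout : G.out x = {w, b}) (hself : σ.outcome h ≠ x)
    (hw : σ.outcome (h ++ [{w}]) = w)
    (hb : ∀ B, rule.Legal x B → b ∈ B → B ⊆ {w, b} → σ.outcome (h ++ [B]) ∉ ({w, b} : Finset _)) :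
    σ.outcome h = w := by
  have hwout : w ∈ G.out x := by simp [hout]
  have hleg := rule.legal_singleton (G.ne_of_mem_out hwout)
  have hmem := hσ.outcome_mem_out hl hx hleg (hw.symm ▸ hwout) hself
  obtain ⟨hsub, hcard⟩ := hσ.subset_out_of_utility_le hl hx hleg (by simpa using hwout)
    (by rw [hw, G.utility_of_mem hmem, G.utility_of_mem hwout])
  rw [hout] at hsub hmem
  have hstep := σ.outcome_append_self (h := h) (hx ▸ x.2)
  have hbσ : b ∉ σ h := fun hbσ =>
    hb _ (hσ.legal.legal hl hx) hbσ hsub (hstep.symm ▸ hmem)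
  have hσw : σ h ⊆ {w} := fun y hy => by
    rcases Finset.mem_insert.mp (hsub hy) with rfl | hy'
    · exact Finset.mem_singleton_self _
    · exact absurd (Finset.mem_singleton.mp hy' ▸ hy) hbσ
  rw [← hstep, Finset.eq_of_subset_of_card_le hσw hcard, hw]

end IsTruthBiased

theorem IsTruthBiased.mem_of_committed (hσ : G.IsTruthBiased rule σ) (hl : rule.LegalHistory h)
    (hx : h.length = x) (hu : G.Uninterested x (σ.outcome h)) (hc : G.Committed rule x a) :
    a ∈ σ h := by
  have hutil : ∀ B, G.utility x (σ.outcome h) ≤ G.utility x (σ.outcome (h ++ [B])) := fun B =>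
    hu.utility_eq ▸ G.utility_nonneg _ _
  cases rule
  · obtain ⟨hsub, hcard⟩ := hσ.subset_out_of_utility_le hl hx
      (VotingRule.legal_singleton _ (G.ne_of_mem_out hc.mem_out))
      (Finset.singleton_subset_iff.mpr hc.mem_out) (hutil _)
    rw [Finset.eq_of_subset_of_card_le (show σ h ⊆ {a} from hc ▸ hsub) hcard]
    exact Finset.mem_singleton_self a
  · obtain ⟨hsub, hcard⟩ := hσ.subset_out_of_utility_le hl hx (G.not_mem_self x) subset_rfl
      (hutil _)
    rw [Finset.eq_of_subset_of_card_le hsub hcard]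
    exact hc

namespace IsTruthBiased

variable (hσ : G.IsTruthBiased rule σ) (hl : rule.LegalHistory h)

include hσ hl

theorem potential_append_self_le (hx : h.length = x)
    (hu : a ≠ x → a ∉ G.out x → G.Uninterested x (σ.outcome h)) :
    G.potential (h ++ [σ h]) a ≤ G.potential h a := by
  have hmem : a ∈ σ h → a ∈ G.out x := fun ha => by
    by_contra hout
    have hax : a ≠ x := fun e => (hσ.legal.legal hl hx).notMem (e ▸ ha)
    exact hout (hσ.subset_out_of_uninterested hl hx (hu hax hout) ha)
  have := potential_append (G := G) hx (σ h) a
  grind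

theorem potential_le_append_self_add (hx : h.length = x) {s : Finset (Fin n)}
    (hs : a ∈ G.out x → x ∉ s → G.Committed rule x a ∧ G.Uninterested x (σ.outcome h)) :
    G.potential h a ≤ G.potential (h ++ [σ h]) a + if x ∈ s then 1 else 0 := by
  have hmem : a ∈ G.out x → x ∉ s → a ∈ σ h := fun ha hxs =>
    hσ.mem_of_committed hl hx (hs ha hxs).2 (hs ha hxs).1
  have := potential_append (G := G) hx (σ h) a
  grind

theorem potential_steps_le {m : ℕ} (hm : h.length + m ≤ n)
    (hu : ∀ x : Fin n, h.length ≤ x → x < h.length + m → a ≠ x → a ∉ G.out x →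
      G.Uninterested x (σ.outcome h)) :
    G.potential (σ.steps m h) a ≤ G.potential h a := by
  induction m generalizing h with
  | zero => rfl
  | succ m ih =>
    have hh : h.length < n := by omega
    refine (ih (hσ.legalHistory_append_self hl (x := ⟨_, hh⟩) rfl) (by simp; omega) ?_).trans
      (hσ.potential_append_self_le hl (x := ⟨_, hh⟩) rfl (hu _ le_rfl (by simp)))
    simp only [List.length_append, List.length_singleton]
    rw [σ.outcome_append_self hh]
    exact fun x h1 h2 => hu x (by omega) (by omega)

theorem potential_steps_outcome_le {m : ℕ} (hm : h.length + m ≤ n) :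
    G.potential (σ.steps m h) (σ.outcome h) ≤ G.potential h (σ.outcome h) :=
  hσ.potential_steps_le hl hm fun _ _ _ h1 h2 => ⟨h1, h2⟩

theorem potential_le_steps_add {m : ℕ} (hm : h.length + m ≤ n) (s : Finset (Fin n))
    (hs : ∀ x : Fin n, h.length ≤ x → x < h.length + m → a ∈ G.out x → x ∉ s →
      G.Committed rule x a ∧ G.Uninterested x (σ.outcome h)) :
    G.potential h a ≤ G.potential (σ.steps m h) a + s.card := by
  induction m generalizing h s with
  | zero => exact Nat.le_add_right _ _
  | succ m ih =>
    have hh : h.length < n := by omega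
    have hstep := hσ.potential_le_append_self_add hl (x := ⟨_, hh⟩) rfl (s := s)
      (hs _ le_rfl (by simp))
    have hrest := ih (hσ.legalHistory_append_self hl (x := ⟨_, hh⟩) rfl) (by simp; omega)
      (s.erase ⟨h.length, hh⟩) (by
        simp only [List.length_append, List.length_singleton]
        rw [σ.outcome_append_self hh]
        intro x h1 h2 ha hxs
        refine hs x (by omega) (by omega) ha fun hx => hxs (Finset.mem_erase.mpr ⟨?_, hx⟩)
        exact fun e => by simp [e] at h1)
    have hcard : (s.erase ⟨h.length, hh⟩).card + (if ⟨h.length, hh⟩ ∈ s then 1 else 0) =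
        s.card := by
      split_ifs with hmem
      · exact Finset.card_erase_add_one hmem
      · rw [Finset.erase_eq_of_notMem hmem, add_zero]
    rw [Profile.steps]
    omega

theorem outcome_ne_of_lt {t : ℕ} (ht : h.length ≤ t) (htn : t ≤ n) (s : Finset (Fin n))
    (hs : ∀ x : Fin n, t ≤ x → a ∈ G.out x → x ∉ s → G.Committed rule x a ∧ G.Uninterested x v)
    (hlt : G.potential h v + s.card <
      score h a + G.likersFrom t a + if a < v then 1 else 0) :
    σ.outcome h ≠ v := by
  rintro rfl
  obtain ⟨m, rfl⟩ := Nat.exists_eq_add_of_le ht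
  have hscore := σ.score_le_score_steps m h a
  have hv := hσ.potential_steps_outcome_le hl htn
  have hlen := σ.length_steps m h
  have hlg := hl.steps hσ.legal htn
  rw [← σ.outcome_steps htn] at hs hv hlt
  generalize σ.steps m h = g at *
  have hgn : g.length + (n - g.length) ≤ n := by omega
  have hpot : ∀ b, G.potential (σ.complete g) b = score (σ.complete g) b := fun b => by
    have : (σ.complete g).length = n := by rw [Profile.complete, σ.length_steps]; omega
    rw [potential, this, likersFrom_self, add_zero]
  have ha : G.potential g a ≤ G.potential (σ.complete g) a + s.card :=
    hσ.potential_le_steps_add hlg hgn s fun x hx _ => hs x (hlen ▸ hx)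
  have hgv : G.potential (σ.complete g) (σ.outcome g) ≤ G.potential g (σ.outcome g) :=
    hσ.potential_steps_outcome_le hlg hgn
  have hwin : score (σ.complete g) a + (if a < σ.outcome g then 1 else 0) ≤
    score (σ.complete g) (σ.outcome g) := score_add_ite_lt_le_score_winner _ a
  rw [hpot] at ha hgv
  rw [potential, hlen] at ha
  omega

end IsTruthBiased

theorem achievable_eq_singleton (hε : 0 < ε) (hεn : ε < 1 / (2 * (n : ℝ)))
    (hw : ∀ σ, G.IsTruthBiased rule σ → σ.outcome [] = w) : G.achievable rule ε = {w} := by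
  ext v
  simp only [achievable, Set.mem_ofPred_eq, isWinner_iff, Set.mem_singleton_iff]
  constructor
  · rintro ⟨σ, hσ, rfl⟩
    exact hw σ (hσ.isTruthBiased hε hεn)
  · rintro rfl
    have hopt := G.isSPE_optimalProfile rule ε
    exact ⟨_, hopt, hw _ (hopt.isTruthBiased hε hεn)⟩

end Network

/-! ### Networks consisting of a core and its fans -/

/-- A blueprint for a network. The agents `x < size` form the core and confirm `confirms x`. Each
core agent `a` has `fans a` fans, who vote after the core and confirm `a` only. The core is
followed by `size` groups of `maxFans` agents; the first `fans a` agents of group number `a` are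
the fans of `a`, and the others confirm nobody. -/
structure Core where
  size : ℕ
  size_pos : 0 < size
  confirms : ℕ → Finset ℕ
  confirms_lt : ∀ x < size, ∀ a ∈ confirms x, a < size
  not_mem_self : ∀ x < size, x ∉ confirms x
  maxFans : ℕ
  fans : ℕ → ℕ
  fans_le : ∀ a, fans a ≤ maxFans

namespace Core

variable (C : Core)

/-- The number of agents of the network. -/
def numAgents : ℕ := C.size + C.size * C.maxFans

theorem size_le_numAgents : C.size ≤ C.numAgents := Nat.le_add_right _ _

instance : NeZero C.numAgents := ⟨(C.size_pos.trans_le C.size_le_numAgents).ne'⟩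

/-- The network with the given blueprint. -/
def network : Network C.numAgents where
  out x := Finset.univ.filter fun a =>
    if (x : ℕ) < C.size then (a : ℕ) ∈ C.confirms x
    else (a : ℕ) = (x - C.size) / C.maxFans ∧ (x - C.size) % C.maxFans < C.fans a
  not_mem_self x := by
    have hx := x.2
    simp only [Finset.mem_filter, Finset.mem_univ, true_and]
    split_ifs with h
    · exact C.not_mem_self x h
    · rintro ⟨hdiv, -⟩
      unfold numAgents at hx
      have := Nat.div_lt_of_lt_mul (m := x - C.size) (n := C.maxFans) (k := C.size)
        (by rw [mul_comm]; omega)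
      omega

/-- The popularity of the core agent `a`. -/
def popularity (a : ℕ) : ℕ :=
  ((Finset.range C.size).filter fun x => a ∈ C.confirms x).card + C.fans a

variable {C} {rule : VotingRule} {x a v : Fin C.numAgents}

theorem mem_out_of_lt (hx : (x : ℕ) < C.size) : a ∈ C.network.out x ↔ (a : ℕ) ∈ C.confirms x := by
  simp [network, hx]

theorem mem_out_of_le (hx : C.size ≤ (x : ℕ)) : a ∈ C.network.out x ↔
    (a : ℕ) = (x - C.size) / C.maxFans ∧ (x - C.size) % C.maxFans < C.fans a := by
  simp [network, hx.not_gt]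

theorem out_eq_singleton (hx : C.size ≤ (x : ℕ)) (ha : a ∈ C.network.out x) :
    C.network.out x = {a} := by
  ext b
  rw [Finset.mem_singleton]
  refine ⟨fun hb => ?_, fun hb => hb ▸ ha⟩
  rw [mem_out_of_le hx] at ha hb
  exact Fin.ext (hb.1.trans ha.1.symm)

theorem committed_of_le (hx : C.size ≤ (x : ℕ)) (ha : a ∈ C.network.out x) :
    C.network.Committed rule x a := by
  cases rule
  · exact out_eq_singleton hx ha
  · exact ha

theorem uninterested_of_le (hx : C.size ≤ (x : ℕ)) (ha : a ∈ C.network.out x)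
    (hv : (v : ℕ) < C.size) (hva : v ≠ a) : C.network.Uninterested x v :=
  ⟨fun e => by omega, by simpa [out_eq_singleton hx ha] using hva⟩

theorem out_eq_of_confirms_eq {s : Finset (Fin C.numAgents)} (hx : (x : ℕ) < C.size)
    (hs : C.confirms x = s.map Fin.valEmbedding) : C.network.out x = s := by
  ext a
  rw [mem_out_of_lt hx, hs]
  simp [Fin.val_inj]

theorem card_filter_fans (ha : (a : ℕ) < C.size) :
    (Finset.univ.filter fun x : Fin C.numAgents => C.size ≤ x ∧ a ∈ C.network.out x).card =
      C.fans a := by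
  have hIco : (Finset.univ.filter fun x : Fin C.numAgents => C.size ≤ x ∧ a ∈ C.network.out x).map
      Fin.valEmbedding =
      Finset.Ico (C.size + a * C.maxFans) (C.size + a * C.maxFans + C.fans a) := by
    ext x
    have hle := C.fans_le a
    have hmul : (a + 1) * C.maxFans ≤ C.size * C.maxFans := Nat.mul_le_mul_right _ ha
    simp only [Finset.mem_map, Finset.mem_filter, Finset.mem_univ, true_and, Finset.mem_Ico,
      Fin.valEmbedding_apply]
    constructor
    · rintro ⟨x, ⟨hx, hax⟩, rfl⟩
      obtain ⟨hdiv, hmod⟩ := (mem_out_of_le hx).mp hax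
      have := Nat.div_add_mod' (x - C.size) C.maxFans
      rw [← hdiv] at this
      omega
    · rintro ⟨hlo, hhi⟩
      obtain ⟨r, rfl⟩ := Nat.exists_eq_add_of_le hlo
      have hr : r < C.maxFans := by omega
      refine ⟨⟨C.size + a * C.maxFans + r, by unfold numAgents; linarith⟩, ?_, rfl⟩
      have hle' : C.size ≤ C.size + a * C.maxFans + r := by omega
      refine ⟨hle', (mem_out_of_le hle').mpr ?_⟩
      have hsub : C.size + a * C.maxFans + r - C.size = r + C.maxFans * a := by
        rw [mul_comm]; omega
      simp only [hsub, Nat.add_mul_div_left _ _ (Nat.zero_lt_of_lt hr), Nat.div_eq_of_lt hr,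
        zero_add, Nat.add_mul_mod_self_left, Nat.mod_eq_of_lt hr, true_and]
      omega
  rw [← Finset.card_map Fin.valEmbedding, hIco, Nat.card_Ico, Nat.add_sub_cancel_left]

theorem likersFrom_eq {t : ℕ} (ht : t ≤ C.size) (ha : (a : ℕ) < C.size) :
    C.network.likersFrom t a =
      ((Finset.Ico t C.size).filter fun x => (a : ℕ) ∈ C.confirms x).card + C.fans a := by
  have hsplit : (Finset.univ.filter fun x : Fin C.numAgents => t ≤ x ∧ a ∈ C.network.out x) =
      (Finset.univ.filter fun x : Fin C.numAgents => t ≤ x ∧ x < C.size ∧ a ∈ C.network.out x) ∪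
      (Finset.univ.filter fun x : Fin C.numAgents => C.size ≤ x ∧ a ∈ C.network.out x) := by
    ext x
    simp only [Finset.mem_union, Finset.mem_filter, Finset.mem_univ, true_and]
    grind
  rw [Network.likersFrom, hsplit, Finset.card_union_of_disjoint, card_filter_fans ha,
    ← Finset.card_map Fin.valEmbedding]
  · congr 2
    ext x
    simp only [Finset.mem_map, Finset.mem_filter, Finset.mem_univ, true_and, Finset.mem_Ico,
      Fin.valEmbedding_apply]
    constructor
    · rintro ⟨x, ⟨htx, hx, hax⟩, rfl⟩
      exact ⟨⟨htx, hx⟩, (mem_out_of_lt hx).mp hax⟩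
    · rintro ⟨⟨htx, hx⟩, hax⟩
      exact ⟨⟨x, hx.trans_le C.size_le_numAgents⟩, ⟨htx, hx, (mem_out_of_lt hx).mpr hax⟩, rfl⟩
  · rw [Finset.disjoint_filter]
    rintro x - ⟨-, hx, -⟩ ⟨hx', -⟩
    omega

theorem popularity_network (ha : (a : ℕ) < C.size) :
    C.network.popularity a = C.popularity a := by
  rw [← Network.likersFrom_zero, likersFrom_eq (Nat.zero_le _) ha, popularity,
    Finset.range_eq_Ico]

theorem lt_size_of_mem_out (ha : a ∈ C.network.out x) : (a : ℕ) < C.size := by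
  rcases lt_or_ge (x : ℕ) C.size with hx | hx
  · exact C.confirms_lt x hx a ((mem_out_of_lt hx).mp ha)
  · rw [((mem_out_of_le hx).mp ha).1]
    have hxn := x.2
    unfold numAgents at hxn
    exact Nat.div_lt_of_lt_mul (by rw [mul_comm]; omega)

theorem likersFrom_of_size_le (t : ℕ) (ha : C.size ≤ (a : ℕ)) : C.network.likersFrom t a = 0 := by
  rw [Network.likersFrom, Finset.card_eq_zero, Finset.filter_eq_empty_iff]
  exact fun x _ hx => (lt_size_of_mem_out hx.2).not_ge ha

theorem card_out_of_lt (hx : (x : ℕ) < C.size) :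
    (C.network.out x).card = (C.confirms x).card := by
  rw [← Finset.card_map Fin.valEmbedding]
  congr 1
  ext a
  simp only [Finset.mem_map, Fin.valEmbedding_apply]
  constructor
  · rintro ⟨a, ha, rfl⟩
    exact (mem_out_of_lt hx).mp ha
  · exact fun ha => ⟨⟨a, (C.confirms_lt x hx a ha).trans_le C.size_le_numAgents⟩,
      (mem_out_of_lt hx).mpr ha, rfl⟩

theorem maxOut_network {d : ℕ} (hd : 1 ≤ d) (hle : ∀ x < C.size, (C.confirms x).card ≤ d)
    {y : ℕ} (hy : y < C.size) (hcard : (C.confirms y).card = d) : C.network.maxOut = d := by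
  refine le_antisymm (Finset.sup_le fun x _ => ?_) ?_
  · rcases lt_or_ge (x : ℕ) C.size with hx | hx
    · exact (card_out_of_lt hx).trans_le (hle x hx)
    · refine (Finset.card_le_one.mpr fun a ha b hb => ?_).trans hd
      rw [out_eq_singleton hx hb] at ha
      exact Finset.mem_singleton.mp ha
  · let y' : Fin C.numAgents := ⟨y, hy.trans_le C.size_le_numAgents⟩
    calc d = (C.network.out y').card := by rw [card_out_of_lt hy, hcard]
      _ ≤ C.network.maxOut :=
        Finset.le_sup (f := fun x => (C.network.out x).card) (Finset.mem_univ y')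

theorem maxIn_network {top : ℕ} (htop : top < C.size)
    (hle : ∀ a < C.size, C.popularity a ≤ C.popularity top) :
    C.network.maxIn = C.popularity top := by
  refine le_antisymm (Finset.sup_le fun a _ => ?_) ?_
  · rcases lt_or_ge (a : ℕ) C.size with ha | ha
    · exact (popularity_network ha).trans_le (hle a ha)
    · rw [← Network.likersFrom_zero, likersFrom_of_size_le 0 ha]
      exact Nat.zero_le _
  · rw [← popularity_network (a := ⟨top, htop.trans_le C.size_le_numAgents⟩) htop]
    exact Finset.le_sup (Finset.mem_univ _)

theorem agentGap_network {w top : ℕ} (hw : w < C.size) (hout : C.confirms w = ∅)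
    (htop : top < C.size) (hle : ∀ a < C.size, C.popularity a ≤ C.popularity top) :
    C.network.agentGap ⟨w, hw.trans_le C.size_le_numAgents⟩ =
      (C.popularity top : ℤ) - C.popularity w := by
  have hempty : C.network.out ⟨w, hw.trans_le C.size_le_numAgents⟩ = ∅ :=
    out_eq_of_confirms_eq hw (by simp [hout])
  rw [Network.agentGap, Network.removeOut_eq_self hempty, maxIn_network htop hle,
    popularity_network hw]

variable {σ : Profile C.numAgents} {h : List (Ballot C.numAgents)}

theorem outcome_lt_size_and_fans_pos (hσ : C.network.IsTruthBiased rule σ)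
    (hl : rule.LegalHistory h) (hh : h.length ≤ C.size) (ha : (a : ℕ) < C.size)
    (hfans : C.size + 1 < C.fans a) :
    (σ.outcome h : ℕ) < C.size ∧ 0 < C.fans (σ.outcome h) := by
  by_contra hv
  have hpot : C.network.potential h (σ.outcome h) ≤ C.size := by
    have hscore := score_le_length h (σ.outcome h)
    rw [Network.potential]
    rcases lt_or_ge (σ.outcome h : ℕ) C.size with hlt | hge
    · have hcard := Finset.card_filter_le (Finset.Ico h.length C.size)
        fun x => (σ.outcome h : ℕ) ∈ C.confirms x
      rw [Nat.card_Ico] at hcard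
      rw [likersFrom_eq hh hlt]
      omega
    · rw [likersFrom_of_size_le _ hge]
      omega
  refine hσ.outcome_ne_of_lt hl hh C.size_le_numAgents (a := a) {σ.outcome h}
    (fun x hx hax hxv => ⟨committed_of_le hx hax, ?_⟩) ?_ rfl
  · refine ⟨fun e => hxv (Finset.mem_singleton.mpr e.symm), fun hvout => hv ?_⟩
    rw [out_eq_singleton hx hax, Finset.mem_singleton] at hvout
    rw [hvout]
    omega
  · rw [likersFrom_eq le_rfl ha, Finset.card_singleton]
    omega

theorem exists_network_of_outcome_eq (C : Core) (rule : VotingRule) {d k w top y : ℕ} (hd : 1 ≤ d)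
    (hout : ∀ x < C.size, (C.confirms x).card ≤ d) (hy : y < C.size)
    (hcard : (C.confirms y).card = d) (hw : w < C.size) (hwout : C.confirms w = ∅)
    (htop : top < C.size) (hle : ∀ a < C.size, C.popularity a ≤ C.popularity top)
    (hgap : C.popularity w + k = C.popularity top)
    (houtcome : ∀ σ, C.network.IsTruthBiased rule σ → (σ.outcome [] : ℕ) = w) :
    ∃ (n : ℕ) (G : Network n) (w : Fin n), G.maxOut = d ∧
      (G.popularity w : ℤ) = (G.maxIn : ℤ) - (k : ℤ) ∧
      ∀ ε : ℝ, 0 < ε → ε < 1 / (2 * (n : ℝ)) →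
        G.achievable rule ε = {w} ∧ G.additiveGap rule ε = (k : ℤ) := by
  refine ⟨_, C.network, ⟨w, hw.trans_le C.size_le_numAgents⟩, maxOut_network hd hout hy hcard, ?_,
    fun ε hε hεn => ?_⟩
  · rw [maxIn_network htop hle, popularity_network hw, ← hgap]
    push_cast
    ring
  · have hach := Network.achievable_eq_singleton hε hεn
      (w := ⟨w, hw.trans_le C.size_le_numAgents⟩) fun σ hσ => Fin.ext (houtcome σ hσ)
    refine ⟨hach, ?_⟩
    rw [Network.additiveGap_of_achievable_eq hach, agentGap_network hw hwout htop hle, ← hgap]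
    push_cast
    ring

end Core

/-! ### Approval voting -/

namespace Network.IsTruthBiased

variable {n : ℕ} [NeZero n] {G : Network n} {σ : Profile n} {h : List (Ballot n)} {x v : Fin n}

theorem outcome_ne_of_sincere (hσ : G.IsTruthBiased .approval σ)
    (hl : VotingRule.approval.LegalHistory h) (hx : h.length = x) (hu : G.Uninterested x v)
    (hne : σ.outcome (h ++ [G.out x]) ≠ v) : σ.outcome h ≠ v := by
  rintro rfl
  have hsincere : σ h = G.out x := (hσ.subset_out_of_uninterested hl hx hu).antisymm fun a ha =>
    hσ.mem_of_committed hl hx hu (a := a) ha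
  exact hne (hsincere ▸ σ.outcome_append_self (hx ▸ x.2))

theorem outcome_eq_outcome_sincere (hσ : G.IsTruthBiased .approval σ)
    (hl : VotingRule.approval.LegalHistory h) (hx : h.length = x) (hself : σ.outcome h ≠ x)
    (ho : σ.outcome (h ++ [G.out x]) ∈ G.out x) :
    σ.outcome h = σ.outcome (h ++ [G.out x]) := by
  have hmem := hσ.outcome_mem_out hl hx (G.not_mem_self x) ho hself
  obtain ⟨hsub, hcard⟩ := hσ.subset_out_of_utility_le hl hx (B := G.out x) (G.not_mem_self x)
    subset_rfl (by rw [G.utility_of_mem hmem, G.utility_of_mem ho])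
  rw [← Finset.eq_of_subset_of_card_le hsub hcard, σ.outcome_append_self (hx ▸ x.2)]

end Network.IsTruthBiased

namespace PairNetwork

/-- The place of the candidate `i` among the core agents after the pairs. Candidate `0` is going to
be elected. -/
def place : Fin 4 → ℕ := ![0, 1, 4, 5]

/-- The candidates confirmed by the core agent number `r` after the pairs: between the candidates
`1` and `2` there are two agents who confirm both of these. -/
def lateWish : ℕ → Finset (Fin 4)
  | 1 => {2}
  | 2 | 3 => {1, 2}
  | 4 => {3}
  | 5 => {1}
  | _ => ∅

/-- The candidates confirmed by the core agent `x`: the first `2 * k` agents form pairs, who confirm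
the candidate `0` and, alternately, `1` and `2`. -/
def wish (k x : ℕ) : Finset (Fin 4) :=
  if x < 2 * k then {0, if x % 2 = 0 then 1 else 2} else lateWish (x - 2 * k)

theorem place_injective : Function.Injective place := by
  decide

theorem notMem_lateWish (i : Fin 4) : i ∉ lateWish (place i) := by
  revert i
  decide

theorem wish_add (k r : ℕ) : wish k (2 * k + r) = lateWish r := by
  simp [wish]

/-- The numbers of fans are such that, once the pairs have voted, the candidates `1` and `3` are
confirmed by `2 * k + 12` of the remaining agents, and the candidate `2` by one agent fewer. -/
def core (k : ℕ) : Core where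
  size := 2 * k + 6
  size_pos := by omega
  confirms x := (wish k x).image fun i => 2 * k + place i
  confirms_lt x _ a ha := by
    obtain ⟨i, -, rfl⟩ := Finset.mem_image.mp ha
    fin_cases i <;> simp [place]
  not_mem_self x hx hmem := by
    obtain ⟨i, hi, rfl⟩ := Finset.mem_image.mp hmem
    exact notMem_lateWish i (wish_add k _ ▸ hi)
  maxFans := 2 * k + 12
  fans a := if a = 2 * k then 12 else if a = 2 * k + 1 then 2 * k + 9
    else if a = 2 * k + 4 then 2 * k + 8 else if a = 2 * k + 5 then 2 * k + 11 else 0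
  fans_le a := by split_ifs <;> omega

variable {k : ℕ}

theorem add_place_lt (k : ℕ) (i : Fin 4) : 2 * k + place i < (core k).size := by
  fin_cases i <;> simp [core, place]

/-- The candidates. -/
def cand (k : ℕ) : Fin 4 ↪o Fin (core k).numAgents :=
  OrderEmbedding.ofStrictMono
    (fun i => ⟨2 * k + place i, (add_place_lt k i).trans_le (core k).size_le_numAgents⟩)
    fun i j hij => by
      simp only [Fin.lt_def, place]
      fin_cases i <;> fin_cases j <;> simp at hij ⊢

theorem val_cand (i : Fin 4) : (cand k i : ℕ) = 2 * k + place i := rfl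

theorem cand_mem_out {x : Fin (core k).numAgents} (hx : (x : ℕ) < 2 * k + 6) (i : Fin 4) :
    cand k i ∈ (core k).network.out x ↔ i ∈ wish k x := by
  rw [Core.mem_out_of_lt hx, val_cand]
  simp only [core, Finset.mem_image, Nat.add_left_cancel_iff]
  exact ⟨fun ⟨j, hj, hji⟩ => place_injective hji ▸ hj, fun hi => ⟨i, hi, rfl⟩⟩

/-- The ballot for a set of candidates. -/
def ballot (k : ℕ) (s : Finset (Fin 4)) : Ballot (core k).numAgents :=
  s.map (cand k).toEmbedding

theorem cand_mem_ballot {i : Fin 4} {s : Finset (Fin 4)} : cand k i ∈ ballot k s ↔ i ∈ s :=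
  Finset.mem_map' _

theorem out_eq {x : Fin (core k).numAgents} (hx : (x : ℕ) < 2 * k + 6) :
    (core k).network.out x = ballot k (wish k x) :=
  Core.out_eq_of_confirms_eq hx (by
    rw [ballot, Finset.map_map, Finset.map_eq_image]
    rfl)

theorem likersFrom_cand_add (t : ℕ) (ht : t < 2 * k + 6) (i : Fin 4) :
    (core k).network.likersFrom t (cand k i) =
      (core k).network.likersFrom (t + 1) (cand k i) + if i ∈ wish k t then 1 else 0 := by
  have := (core k).network.likersFrom_eq_add ⟨t, ht.trans_le (core k).size_le_numAgents⟩ (cand k i)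
  simpa only [cand_mem_out (x := ⟨t, _⟩) ht] using this

theorem likersFrom_cand_two_mul (i : Fin 4) :
    (core k).network.likersFrom (2 * k) (cand k i) =
      ![12, 2 * k + 12, 2 * k + 11, 2 * k + 12] i := by
  have hfans : (core k).network.likersFrom (2 * k + 6) (cand k i) =
      ![12, 2 * k + 9, 2 * k + 8, 2 * k + 11] i := by
    rw [Core.likersFrom_eq (C := core k) (t := 2 * k + 6) le_rfl (add_place_lt k i), val_cand]
    fin_cases i <;> simp [core, place]
  have hstep : ∀ r < 6, (core k).network.likersFrom (2 * k + r) (cand k i) =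
      (core k).network.likersFrom (2 * k + (r + 1)) (cand k i) +
        if i ∈ lateWish r then 1 else 0 := fun r hr =>
    wish_add k r ▸ likersFrom_cand_add (2 * k + r) (by omega) i
  rw [← add_zero (2 * k), hstep 0 (by simp), hstep 1 (by simp), hstep 2 (by simp),
    hstep 3 (by simp), hstep 4 (by simp), hstep 5 (by simp), hfans]
  fin_cases i <;> simp [lateWish]

theorem likersFrom_cand {t j : ℕ} (ht : t + 2 * j = 2 * k) (i : Fin 4) :
    (core k).network.likersFrom t (cand k i) =
      ![12 + 2 * j, 2 * k + 12 + j, 2 * k + 11 + j, 2 * k + 12] i := by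
  induction j generalizing t with
  | zero =>
    obtain rfl : t = 2 * k := by omega
    exact likersFrom_cand_two_mul i
  | succ j ih =>
    rw [likersFrom_cand_add _ (by omega), likersFrom_cand_add _ (by omega), ih (by omega)]
    have heven : t % 2 = 0 := by omega
    have hodd : (t + 1) % 2 = 1 := by omega
    have hlt : t < 2 * k := by omega
    have hlt' : t + 1 < 2 * k := by omega
    fin_cases i <;> simp [wish, heven, hodd, hlt, hlt'] <;> omega

theorem wish_of_even {x : ℕ} (hx : x < 2 * k) (h2 : x % 2 = 0) : wish k x = {0, 1} := by
  simp [wish, hx, h2]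

theorem wish_of_odd {x : ℕ} (hx : x < 2 * k) (h2 : x % 2 = 1) : wish k x = {0, 2} := by
  simp [wish, hx, h2]

/-- The potential of the candidate `i`. -/
def pot (h : List (Ballot (core k).numAgents)) (i : Fin 4) : ℕ :=
  (core k).network.potential h (cand k i)

section Potential

variable {h : List (Ballot (core k).numAgents)}

theorem pot_append (ht : h.length < 2 * k + 6) (B : Ballot (core k).numAgents) (i : Fin 4) :
    pot (h ++ [B]) i + (if i ∈ wish k h.length then 1 else 0) =
      pot h i + if cand k i ∈ B then 1 else 0 := by
  have := Network.potential_append (G := (core k).network)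
    (x := ⟨h.length, ht.trans_le (core k).size_le_numAgents⟩) rfl B (cand k i)
  simpa only [pot, cand_mem_out (x := ⟨h.length, _⟩) ht] using this

theorem pot_append_wish (ht : h.length < 2 * k + 6) :
    pot (h ++ [ballot k (wish k h.length)]) = pot h := by
  funext i
  have := pot_append ht (ballot k (wish k h.length)) i
  simp only [cand_mem_ballot] at this
  omega

theorem legal_append (hl : VotingRule.approval.LegalHistory h) (ht : h.length < 2 * k + 6)
    {s : Finset (Fin 4)} (hs : ∀ i ∈ s, h.length ≠ 2 * k + place i) :
    VotingRule.approval.LegalHistory (h ++ [ballot k s]) := by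
  refine hl.append (x := ⟨h.length, ht.trans_le (core k).size_le_numAgents⟩) rfl fun hmem => ?_
  obtain ⟨i, hi, e⟩ := Finset.mem_map.mp hmem
  exact hs i hi (congrArg Fin.val e).symm

theorem legal_append_wish (hl : VotingRule.approval.LegalHistory h) (ht : h.length < 2 * k + 6) :
    VotingRule.approval.LegalHistory (h ++ [ballot k (wish k h.length)]) :=
  legal_append hl ht fun i hi e => notMem_lateWish i (wish_add k _ ▸ e ▸ hi)

theorem lt_numAgents {x : ℕ} (hx : x < 2 * k + 6) : x < (core k).numAgents :=
  hx.trans_le (core k).size_le_numAgents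

theorem pot_append_add {r : ℕ} (hh : h.length = 2 * k + r) (hr : r < 6)
    (B : Ballot (core k).numAgents) (i : Fin 4) :
    pot (h ++ [B]) i + (if i ∈ lateWish r then 1 else 0) =
      pot h i + if cand k i ∈ B then 1 else 0 := by
  rw [← wish_add k, ← hh]
  exact pot_append (by omega) B i

end Potential

section Steps

variable {σ : Profile (core k).numAgents} {h : List (Ballot (core k).numAgents)} {i j : Fin 4}
  {s : Finset (Fin 4)} (hσ : (core k).network.IsTruthBiased .approval σ)
  (hl : VotingRule.approval.LegalHistory h)

include hσ hl

theorem exists_outcome_eq_cand (hh : h.length ≤ 2 * k + 6) : ∃ i, σ.outcome h = cand k i := by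
  obtain ⟨-, hpos⟩ := Core.outcome_lt_size_and_fans_pos hσ hl hh (a := cand k 1)
    (add_place_lt k 1) (by rw [val_cand]; simp [core, place])
  simp only [core] at hpos
  have hval : ∀ i, (σ.outcome h : ℕ) = 2 * k + place i → σ.outcome h = cand k i :=
    fun i hi => Fin.ext hi
  split_ifs at hpos with h0 h1 h2 h3
  exacts [⟨0, hval 0 h0⟩, ⟨1, hval 1 h1⟩, ⟨2, hval 2 h2⟩, ⟨3, hval 3 h3⟩, absurd hpos (lt_irrefl 0)]

theorem outcome_eq_of_ne (hh : h.length ≤ 2 * k + 6) (hne : ∀ j, j ≠ i → σ.outcome h ≠ cand k j) :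
    σ.outcome h = cand k i := by
  obtain ⟨j, e⟩ := exists_outcome_eq_cand hσ hl hh
  by_contra hi
  exact hne j (fun hji => hi (hji ▸ e)) e

theorem outcome_ne_of_legal (hh : h.length < 2 * k + 6)
    (hne : ∀ B, VotingRule.approval.LegalHistory (h ++ [B]) →
      (∀ j, h.length = 2 * k + place j → cand k j ∉ B) → σ.outcome (h ++ [B]) ≠ cand k i) :
    σ.outcome h ≠ cand k i :=
  hσ.outcome_ne_of_forall hl (x := ⟨h.length, lt_numAgents hh⟩) rfl fun B hB =>
    hne B (hl.append rfl hB) fun j hj => (Fin.ext hj : (⟨_, _⟩ : Fin _) = cand k j) ▸ hB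

theorem outcome_ne_of_wish (hh : h.length < 2 * k + 6) (hi : i ∉ wish k h.length)
    (hplace : h.length ≠ 2 * k + place i)
    (hne : σ.outcome (h ++ [ballot k (wish k h.length)]) ≠ cand k i) : σ.outcome h ≠ cand k i := by
  refine hσ.outcome_ne_of_sincere hl (x := ⟨h.length, lt_numAgents hh⟩) rfl
    ⟨fun e => hplace (congrArg Fin.val e).symm, ?_⟩ (by rwa [out_eq hh])
  rwa [cand_mem_out hh]

theorem outcome_eq_of_append_self (hplace : h.length = 2 * k + place i) (hi : i ∉ s)
    (ho : σ.outcome (h ++ [ballot k s]) = cand k i) : σ.outcome h = cand k i :=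
  hσ.outcome_eq_self hl hplace (mt cand_mem_ballot.mp hi) ho

theorem outcome_eq_of_wish (hh : h.length < 2 * k + 6) (hplace : ∀ i, h.length ≠ 2 * k + place i)
    (hi : i ∈ wish k h.length)
    (ho : σ.outcome (h ++ [ballot k (wish k h.length)]) = cand k i) :
    σ.outcome h = cand k i := by
  let x : Fin (core k).numAgents := ⟨h.length, lt_numAgents hh⟩
  have hout : (core k).network.out x = ballot k (wish k h.length) := out_eq hh
  obtain ⟨j, e⟩ := exists_outcome_eq_cand hσ hl hh.le
  have := hσ.outcome_eq_outcome_sincere hl (x := x) rfl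
    (fun hself => hplace j (e ▸ congrArg Fin.val hself).symm)
    (by rw [hout, ho]; exact cand_mem_ballot.mpr hi)
  rw [this, hout, ho]

theorem outcome_mem_wish (hh : h.length < 2 * k + 6) (hplace : ∀ i, h.length ≠ 2 * k + place i)
    (hi : i ∈ wish k h.length) (ho : σ.outcome (h ++ [ballot k s]) = cand k i) :
    ∃ j ∈ wish k h.length, σ.outcome h = cand k j := by
  have hnotMem : ∀ B : Finset (Fin 4),
      (⟨h.length, lt_numAgents hh⟩ : Fin (core k).numAgents) ∉ ballot k B := fun B hB => by
    obtain ⟨j, -, e⟩ := Finset.mem_map.mp hB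
    exact hplace j (congrArg Fin.val e).symm
  obtain ⟨j, e⟩ := exists_outcome_eq_cand hσ hl hh.le
  have hmem := hσ.outcome_mem_out hl (x := ⟨h.length, lt_numAgents hh⟩) rfl (hnotMem s)
    (ho ▸ (cand_mem_out hh i).mpr hi) fun hself => hplace j (e ▸ congrArg Fin.val hself).symm
  exact ⟨j, (cand_mem_out hh j).mp (e ▸ hmem), e⟩

theorem outcome_ne_of_notMem_wish (hh : h.length < 2 * k + 6)
    (hplace : ∀ i, h.length ≠ 2 * k + place i) (hi : i ∈ wish k h.length)
    (hj : j ∉ wish k h.length) (ho : σ.outcome (h ++ [ballot k s]) = cand k i) :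
    σ.outcome h ≠ cand k j := by
  obtain ⟨l, hl', e⟩ := outcome_mem_wish hσ hl hh hplace hi ho
  rw [e]
  exact (cand k).injective.ne fun hlj => hj (hlj ▸ hl')

theorem outcome_ne_cand_of_lt {t q : ℕ} (ht : h.length ≤ t) (htk : t ≤ 2 * k + 6)
    (hpairs : i ≠ 0 ∧ j ≠ 0 ∨ 2 * k ≤ t) (hq : q = 0 ∨ 2 * k + q ≤ t) (s : Finset (Fin 6))
    (hij : i ≠ j)
    (hs : ∀ r : Fin 6, q ≤ r → i ∈ lateWish r → r ∉ s → j ∉ lateWish r ∧ place j ≠ r)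
    (hlt : pot h j + s.card < score h (cand k i) + (core k).network.likersFrom t (cand k i) +
      if i < j then 1 else 0) : σ.outcome h ≠ cand k j := by
  let exceptions := s.image fun r : Fin 6 => (⟨2 * k + r, lt_numAgents (by omega)⟩ :
    Fin (core k).numAgents)
  have hcard : exceptions.card ≤ s.card := Finset.card_image_le
  refine hσ.outcome_ne_of_lt hl ht (htk.trans (core k).size_le_numAgents) exceptions
    (a := cand k i) (fun x hx hi hxs => ⟨hi, ?_⟩)
    ((Nat.add_le_add_left hcard _).trans_lt (by simpa only [(cand k).lt_iff_lt, pot] using hlt))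
  rcases lt_or_ge (x : ℕ) (2 * k + 6) with hx6 | hx6
  swap
  · exact Core.uninterested_of_le hx6 hi (add_place_lt k j) ((cand k).injective.ne hij.symm)
  rw [cand_mem_out hx6] at hi
  rw [Network.Uninterested, cand_mem_out hx6, ne_eq, Fin.ext_iff, val_cand]
  rcases lt_or_ge (x : ℕ) (2 * k) with hx2 | hx2
  · obtain ⟨hi0, hj0⟩ := hpairs.resolve_right (by omega)
    refine ⟨by omega, ?_⟩
    simp only [wish, hx2, if_true, Finset.mem_insert, Finset.mem_singleton, hi0, hj0,
      false_or] at hi ⊢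
    exact fun e => hij (hi.trans e.symm)
  · obtain ⟨r, hr⟩ := Nat.exists_eq_add_of_le hx2
    rw [hr, wish_add] at hi ⊢
    obtain ⟨hj, hplace⟩ := hs ⟨r, by omega⟩ (show q ≤ r by omega) hi fun hrs =>
      hxs (Finset.mem_image.mpr ⟨_, hrs, Fin.ext hr.symm⟩)
    exact ⟨fun e => hplace (Nat.add_left_cancel e), hj⟩

theorem outcome_ne_cand_of_pot_lt {q : ℕ} (hh : h.length ≤ 2 * k + 6)
    (hpairs : i ≠ 0 ∧ j ≠ 0 ∨ 2 * k ≤ h.length) (hq : q = 0 ∨ 2 * k + q ≤ h.length)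
    (s : Finset (Fin 6)) (hij : i ≠ j)
    (hs : ∀ r : Fin 6, q ≤ r → i ∈ lateWish r → r ∉ s → j ∉ lateWish r ∧ place j ≠ r)
    (hlt : pot h j + s.card < pot h i + if i < j then 1 else 0) : σ.outcome h ≠ cand k j :=
  outcome_ne_cand_of_lt hσ hl le_rfl hh hpairs hq s hij hs hlt

end Steps

section Late

variable {σ : Profile (core k).numAgents} {h : List (Ballot (core k).numAgents)} {i : Fin 4}
  {r : ℕ} (hσ : (core k).network.IsTruthBiased .approval σ)
  (hl : VotingRule.approval.LegalHistory h)

include hσ hl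

theorem outcome_ne_zero_of_lt (hh : 2 * k ≤ h.length) (hh' : h.length ≤ 2 * k + 6) (hi : i ≠ 0)
    (hlt : pot h 0 < pot h i) : σ.outcome h ≠ cand k 0 :=
  outcome_ne_cand_of_pot_lt hσ hl (i := i) (q := 0) hh' (.inr hh) (.inl rfl) ∅ hi
    (by clear hlt; revert i; decide) (by simpa using hlt)

theorem outcome_ne_of_le_zero (hh : 2 * k ≤ h.length) (hh' : h.length ≤ 2 * k + 6) (hi : i ≠ 0)
    (hle : pot h i ≤ pot h 0) : σ.outcome h ≠ cand k i :=
  outcome_ne_cand_of_pot_lt hσ hl (i := 0) (q := 0) hh' (.inr hh) (.inl rfl) ∅ hi.symm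
    (by clear hle; revert i; decide)
    (by simpa [Fin.pos_iff_ne_zero.mpr hi, Nat.lt_succ_iff] using hle)

theorem outcome_ne_three_of_le (hh : h.length ≤ 2 * k + 6) (hle : pot h 3 ≤ pot h 2) :
    σ.outcome h ≠ cand k 3 :=
  outcome_ne_cand_of_pot_lt hσ hl (i := 2) (q := 0) hh (.inl (by decide)) (.inl rfl) ∅ (by decide)
    (by decide) (by simpa [Nat.lt_succ_iff] using hle)

theorem outcome_ne_two_of_add_two_le (hh : h.length ≤ 2 * k + 6) (hle : pot h 2 + 2 ≤ pot h 1) :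
    σ.outcome h ≠ cand k 2 :=
  outcome_ne_cand_of_pot_lt hσ hl (i := 1) (q := 0) hh (.inl (by decide)) (.inl rfl) {2, 3}
    (by decide) (by decide) (by simpa [Nat.lt_succ_iff] using hle)

theorem outcome_eq_three (hh : h.length = 2 * k + 6) (hlt : ∀ i, i ≠ 3 → pot h i < pot h 3) :
    σ.outcome h = cand k 3 :=
  outcome_eq_of_ne hσ hl hh.le fun j hj =>
    outcome_ne_cand_of_pot_lt hσ hl (i := 3) (q := 6) hh.le (.inr (by omega)) (.inr hh.ge) ∅
      hj.symm (fun r hr => by omega) ((hlt j hj).trans_le (Nat.le_add_right _ _))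

theorem outcome_ne_one (hh : h.length + r = 2 * k + 5) (hr : r ≤ 5) (h13 : pot h 1 ≤ pot h 3)
    (hor : pot h 2 < pot h 1 ∨ pot h 1 < pot h 3) : σ.outcome h ≠ cand k 1 := by
  induction r generalizing h with
  | zero =>
    rcases h13.lt_or_eq with h13 | h13
    · exact outcome_ne_cand_of_pot_lt hσ hl (i := 3) (q := 0) (by omega) (.inl (by decide))
        (.inl rfl) ∅ (by decide) (by decide) (by simpa using h13)
    rcases le_or_gt (pot h 1) (pot h 0) with h10 | h01
    · exact outcome_ne_of_le_zero hσ hl (by omega) (by omega) (by decide) h10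
    have hpot := pot_append_add (r := 5) hh (by simp) (ballot k ∅)
    rw [outcome_eq_of_append_self hσ hl (i := 3) (s := ∅) hh (Finset.notMem_empty _)
      (outcome_eq_three hσ (legal_append hl (by omega) (by simp)) (by simpa using hh) fun i hi => by
        fin_cases i <;> grind [lateWish, cand_mem_ballot])]
    exact (cand k).injective.ne (by decide)
  | succ r ih =>
    by_cases hsincere : r = 0 ∨ r = 4
    · have hw : wish k h.length = lateWish (4 - r) := by
        rw [← wish_add k]; congr 1; omega
      refine outcome_ne_of_wish hσ hl (by omega)
        (by rw [hw]; rcases hsincere with rfl | rfl <;> decide) (by simp [place]; omega)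
        (ih (legal_append_wish hl (by omega)) (by simp; omega) (by omega) ?_ ?_) <;>
      rwa [pot_append_wish (by omega)]
    · refine outcome_ne_of_legal hσ hl (by omega) fun B hB hself => ?_
      obtain ⟨q, hq⟩ := Nat.exists_eq_add_of_le (show 2 * k ≤ h.length by omega)
      have hpot := pot_append_add hq (by omega) B
      have hcond : pot (h ++ [B]) 1 ≤ pot (h ++ [B]) 3 ∧
          (pot (h ++ [B]) 2 < pot (h ++ [B]) 1 ∨ pot (h ++ [B]) 1 < pot (h ++ [B]) 3) := by
        have h1 : h.length = 2 * k + 1 → cand k 1 ∉ B := hself 1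
        have hq1 : 1 ≤ q := by omega
        have hq3 : q ≤ 3 := by omega
        interval_cases q <;> grind [lateWish]
      exact ih hB (by simp; omega) (by omega) hcond.1 hcond.2

theorem outcome_eq_one (hh : h.length + r = 2 * k + 4) (hr : r ≤ 2) (h21 : pot h 2 ≤ pot h 1)
    (h32 : pot h 3 ≤ pot h 2) (h01 : pot h 0 < pot h 1) : σ.outcome h = cand k 1 := by
  induction r generalizing h with
  | zero =>
    have h12 : σ.outcome h ≠ cand k 2 :=
      outcome_ne_cand_of_pot_lt hσ hl (i := 1) (q := 4) (by omega) (.inl (by decide))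
        (.inr (by omega)) ∅ (by decide) (by decide) (by simpa [Nat.lt_succ_iff] using h21)
    have h0 := outcome_ne_zero_of_lt hσ hl (i := 1) (by omega) (by omega) (by decide) h01
    have h3 := outcome_ne_three_of_le hσ hl (by omega) h32
    exact outcome_eq_of_ne hσ hl (by omega) fun j hj => by fin_cases j <;> trivial
  | succ r ih =>
    have hw : wish k h.length = lateWish (3 - r) := by
      rw [← wish_add k]; congr 1; omega
    refine outcome_eq_of_wish hσ hl (by omega) (fun i => by fin_cases i <;> simp [place] <;> omega)
      (by rw [hw]; rcases (show r = 0 ∨ r = 1 by omega) with rfl | rfl <;> decide)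
      (ih (legal_append_wish hl (by omega)) (by simp; omega) (by omega) ?_ ?_ ?_) <;>
    rwa [pot_append_wish (by omega)]

theorem outcome_ne_two_at_one (hh : h.length = 2 * k + 1) (h01 : pot h 0 < pot h 1)
    (hor : pot h 2 + 2 ≤ pot h 1 ∨ (pot h 2 + 1 = pot h 1 ∧ pot h 3 + 1 ≤ pot h 1) ∨
      (pot h 1 ≤ pot h 2 ∧ pot h 2 ≤ pot h 1 + 1 ∧ pot h 3 ≤ pot h 1)) :
    σ.outcome h ≠ cand k 2 := by
  by_cases hgap : pot h 2 + 2 ≤ pot h 1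
  · exact outcome_ne_two_of_add_two_le hσ hl (by omega) hgap
  have hself (s : Finset (Fin 4)) (hs : 1 ∉ s) (h21 : pot (h ++ [ballot k s]) 2 ≤ pot h 1)
      (h32 : pot (h ++ [ballot k s]) 3 ≤ pot (h ++ [ballot k s]) 2)
      (h0 : pot (h ++ [ballot k s]) 0 ≤ pot h 0) : σ.outcome h ≠ cand k 2 := by
    have hpot := pot_append_add hh (by simp) (ballot k s) 1
    have h11 : pot (h ++ [ballot k s]) 1 = pot h 1 := by grind [lateWish, cand_mem_ballot]
    have hplace : ∀ i ∈ s, h.length ≠ 2 * k + place i := fun i hi e => by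
      obtain rfl : i = 1 := place_injective (Nat.add_left_cancel (e.symm.trans hh))
      exact hs hi
    rw [outcome_eq_of_append_self hσ hl (i := 1) hh hs (outcome_eq_one hσ
      (legal_append hl (by omega) hplace) (r := 2) (by simp; omega) le_rfl (by omega) h32
      (by omega))]
    exact (cand k).injective.ne (by decide)
  rcases lt_or_ge (pot h 1) (pot h 2) with h12 | h21
  · have hpot := pot_append_add hh (by simp) (ballot k ∅)
    refine hself ∅ (by decide) ?_ ?_ ?_ <;> grind [lateWish, cand_mem_ballot]
  · have hpot := pot_append_add hh (by simp) (ballot k {2})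
    refine hself {2} (by decide) ?_ ?_ ?_ <;> grind [lateWish, cand_mem_ballot]

theorem outcome_ne_two_at_zero (hh : h.length = 2 * k) (h01 : pot h 0 < pot h 1)
    (hor : pot h 2 + 2 ≤ pot h 1 ∨ (pot h 2 + 1 = pot h 1 ∧ pot h 3 + 1 ≤ pot h 1) ∨
      (pot h 1 ≤ pot h 2 ∧ pot h 2 ≤ pot h 1 + 1 ∧ pot h 3 ≤ pot h 1)) :
    σ.outcome h ≠ cand k 2 := by
  have hw : wish k h.length = ∅ := by rw [hh]; exact wish_add k 0
  refine outcome_ne_of_wish hσ hl (by omega) (by simp [hw]) (by simp [place]; omega)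
    (outcome_ne_two_at_one hσ (legal_append_wish hl (by omega)) (by simp [hh]) ?_ ?_) <;>
  rwa [pot_append_wish (by omega)]

theorem outcome_eq_one_or_eq_two (hh : h.length + r = 2 * k + 4) (hr : r ≤ 2)
    (h12 : pot h 1 + 1 = pot h 2 + r) (h32 : pot h 3 = pot h 2 + 1) (h02 : pot h 0 < pot h 2) :
    σ.outcome h = cand k 1 ∨ σ.outcome h = cand k 2 := by
  induction r generalizing h with
  | zero =>
    have hl' := legal_append (s := ∅) hl (by omega) (by simp)
    have hpot := pot_append_add (r := 4) hh (by simp) (ballot k ∅)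
    refine .inr (outcome_eq_of_append_self hσ hl (s := ∅) hh (by simp)
      (outcome_eq_of_ne hσ hl' (by simp; omega) fun j hj => ?_))
    have h0 := outcome_ne_zero_of_lt hσ hl' (i := 2) (by simp; omega) (by simp; omega) (by decide)
      (by grind [lateWish, cand_mem_ballot])
    have h1 := outcome_ne_cand_of_pot_lt hσ hl' (i := 2) (j := 1) (q := 4) (by simp; omega)
      (.inl (by decide)) (.inr (by simp; omega)) ∅ (by decide) (by decide)
      (by grind [lateWish, cand_mem_ballot])
    have h3 := outcome_ne_three_of_le hσ hl' (by simp; omega) (by grind [lateWish, cand_mem_ballot])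
    fin_cases j <;> trivial
  | succ r ih =>
    obtain ⟨q, hq⟩ := Nat.exists_eq_add_of_le (show 2 * k ≤ h.length by omega)
    have hw : wish k h.length = {1, 2} := by
      rw [hq, wish_add]
      have : q = 2 ∨ q = 3 := by omega
      rcases this with rfl | rfl <;> rfl
    have hplace : ∀ i, h.length ≠ 2 * k + place i :=
      fun i => by fin_cases i <;> simp [place] <;> omega
    have hpot := pot_append (h := h) (by omega) (ballot k {2})
    have hnext := ih (legal_append (s := {2}) hl (by omega) fun i _ => hplace i)
      (by simp; omega) (by omega) (by grind [cand_mem_ballot]) (by grind [cand_mem_ballot])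
      (by grind [cand_mem_ballot])
    have hstep {i} (hi : i = 1 ∨ i = 2) (ho : σ.outcome (h ++ [ballot k {2}]) = cand k i) :
        σ.outcome h = cand k 1 ∨ σ.outcome h = cand k 2 := by
      obtain ⟨j, hj, e⟩ := outcome_mem_wish hσ hl (by omega) hplace (by simpa [hw] using hi) ho
      rw [hw, Finset.mem_insert, Finset.mem_singleton] at hj
      rcases hj with rfl | rfl
      exacts [.inl e, .inr e]
    exact hnext.elim (hstep (.inl rfl)) (hstep (.inr rfl))

theorem outcome_ne_three (hh : h.length = 2 * k) (h12 : pot h 1 = pot h 2 + 1)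
    (h32 : pot h 3 = pot h 2 + 1) (h02 : pot h 0 < pot h 2) : σ.outcome h ≠ cand k 3 := by
  have hstep {r} {h : List (Ballot (core k).numAgents)} (hl : VotingRule.approval.LegalHistory h)
      (hh : h.length = 2 * k + r) (hr : r < 2)
      (ho : ∀ B, VotingRule.approval.LegalHistory (h ++ [B]) → pot (h ++ [B]) = pot h →
        σ.outcome (h ++ [B]) ≠ cand k 3) : σ.outcome h ≠ cand k 3 := by
    refine outcome_ne_of_wish hσ hl (by omega) ?_ (by simp [place]; omega)
      (ho _ (legal_append_wish hl (by omega)) (pot_append_wish (by omega)))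
    rw [hh, wish_add]
    interval_cases r <;> decide
  refine hstep hl (r := 0) hh (by simp) fun A hA hpotA =>
    hstep hA (r := 1) (by simp [hh]) (by simp) fun B hB hpotB => ?_
  have hpot := hpotB.trans hpotA
  rcases outcome_eq_one_or_eq_two hσ hB (r := 2) (by simp [hh]) le_rfl (by rw [hpot]; omega)
    (by rw [hpot]; omega) (by rw [hpot]; omega) with e | e <;>
  · rw [e]
    exact (cand k).injective.ne (by decide)

end Late

section Pairs

variable {σ : Profile (core k).numAgents} {h : List (Ballot (core k).numAgents)} {j : ℕ}

theorem pot_eq (hh : h.length + 2 * j = 2 * k) (i : Fin 4) :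
    pot h i = score h (cand k i) + ![12 + 2 * j, 2 * k + 12 + j, 2 * k + 11 + j, 2 * k + 12] i := by
  rw [pot, Network.potential, likersFrom_cand hh]

theorem pot_one_eq (hh : h.length = 2 * k) : pot h 1 = score h (cand k 1) + (2 * k + 12) := by
  simpa using pot_eq (j := 0) hh 1

theorem pot_append_of_even (hh : h.length + 2 * (j + 1) = 2 * k) (B : Ballot (core k).numAgents)
    (i : Fin 4) : pot (h ++ [B]) i + (if i ∈ ({0, 1} : Finset (Fin 4)) then 1 else 0) =
      pot h i + if cand k i ∈ B then 1 else 0 := by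
  rw [← wish_of_even (k := k) (x := h.length) (by omega) (by omega)]
  exact pot_append (by omega) B i

theorem pot_append_of_odd (hh : h.length + 2 * j + 1 = 2 * k) (B : Ballot (core k).numAgents)
    (i : Fin 4) : pot (h ++ [B]) i + (if i ∈ ({0, 2} : Finset (Fin 4)) then 1 else 0) =
      pot h i + if cand k i ∈ B then 1 else 0 := by
  rw [← wish_of_odd (k := k) (x := h.length) (by omega) (by omega)]
  exact pot_append (by omega) B i

theorem pot_zero_append_le (hh : h.length < 2 * k) (B : Ballot (core k).numAgents) :
    pot (h ++ [B]) 0 ≤ pot h 0 := by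
  have hpot := pot_append (h := h) (by omega) B 0
  have hmem : 0 ∈ wish k h.length := by simp [wish, hh]
  split_ifs at hpot <;> omega

/-- No play after the history `h` elects the candidate `0`: his potential is below what the
candidate `1` has without the votes of the remaining pairs. -/
def IsDead (h : List (Ballot (core k).numAgents)) : Prop :=
  pot h 0 < score h (cand k 1) + (2 * k + 12)

theorem IsDead.append (hd : IsDead h) (hh : h.length < 2 * k) (B : Ballot (core k).numAgents) :
    IsDead (h ++ [B]) := by
  have := pot_zero_append_le hh B
  rw [IsDead, score_append] at *
  omega

variable (hσ : (core k).network.IsTruthBiased .approval σ)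
  (hl : VotingRule.approval.LegalHistory h)

include hσ hl

theorem outcome_ne_zero_of_isDead (hh : h.length ≤ 2 * k) (hd : IsDead h) :
    σ.outcome h ≠ cand k 0 :=
  outcome_ne_cand_of_lt hσ hl (i := 1) (q := 0) hh (by omega) (.inr le_rfl) (.inl rfl) ∅ (by decide)
    (by decide) (by simpa [IsDead, likersFrom_cand_two_mul] using hd)

theorem outcome_ne_one_of_ballot (heven : ∀ {g}, VotingRule.approval.LegalHistory g →
      g.length + 2 * j = 2 * k → IsDead g →
      (pot g 2 + 1 = pot g 1 ∧ pot g 1 ≤ pot g 3 + j) ∨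
        (pot g 1 ≤ pot g 2 ∧ pot g 1 + 1 ≤ pot g 3 + j) → σ.outcome g ≠ cand k 1)
    (hh : h.length + 2 * j + 1 = 2 * k) (hd : IsDead h)
    {s : Finset (Fin 4)} (hs : 0 ∉ s)
    (hor : (pot (h ++ [ballot k s]) 2 + 1 = pot (h ++ [ballot k s]) 1 ∧
        pot (h ++ [ballot k s]) 1 ≤ pot (h ++ [ballot k s]) 3 + j) ∨
      (pot (h ++ [ballot k s]) 1 ≤ pot (h ++ [ballot k s]) 2 ∧
        pot (h ++ [ballot k s]) 1 + 1 ≤ pot (h ++ [ballot k s]) 3 + j))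
    (h3 : pot (h ++ [ballot k s]) 3 ≤ pot (h ++ [ballot k s]) 2 ∨
      j = 0 ∧ pot (h ++ [ballot k s]) 2 + 1 = pot (h ++ [ballot k s]) 1 ∧
        pot (h ++ [ballot k s]) 3 = pot (h ++ [ballot k s]) 1) :
    σ.outcome h ≠ cand k 1 := by
  have hplace : ∀ i, h.length ≠ 2 * k + place i := fun i => by omega
  have hw : wish k h.length = {0, 2} := wish_of_odd (by omega) (by omega)
  have hl' := legal_append (s := s) hl (by omega) fun i _ => hplace i
  have hd' : IsDead (h ++ [ballot k s]) := hd.append (by omega) _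
  have hlen : (h ++ [ballot k s]).length + 2 * j = 2 * k := by simp; omega
  have hlt : pot (h ++ [ballot k s]) 0 + 1 <
      score (h ++ [ballot k s]) (cand k 1) + (2 * k + 12) := by
    have := pot_append_of_odd hh (ballot k s) 0
    rw [if_pos (by decide), if_neg (mt cand_mem_ballot.mp hs)] at this
    rw [IsDead] at hd
    rw [score_append]
    omega
  generalize hg : h ++ [ballot k s] = g at *
  have hne3 : σ.outcome g ≠ cand k 3 := by
    rcases h3 with h3 | ⟨rfl, h21, h31⟩
    · exact outcome_ne_three_of_le hσ hl' (by omega) h3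
    · have := pot_one_eq hlen
      exact outcome_ne_three hσ hl' hlen (by omega) (by omega) (by omega)
  have he : σ.outcome g = cand k 2 := outcome_eq_of_ne hσ hl' (by omega) fun i hi => by
    fin_cases i
    exacts [outcome_ne_zero_of_isDead hσ hl' (by omega) hd', heven hl' hlen hd' hor,
      absurd rfl hi, hne3]
  exact outcome_ne_of_notMem_wish hσ hl (by omega) hplace (by simp [hw]) (by simp [hw])
    (hg ▸ he)

theorem outcome_ne_one_of_odd (heven : ∀ {g}, VotingRule.approval.LegalHistory g →
      g.length + 2 * j = 2 * k → IsDead g →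
      (pot g 2 + 1 = pot g 1 ∧ pot g 1 ≤ pot g 3 + j) ∨
        (pot g 1 ≤ pot g 2 ∧ pot g 1 + 1 ≤ pot g 3 + j) → σ.outcome g ≠ cand k 1)
    (hh : h.length + 2 * j + 1 = 2 * k) (hd : IsDead h)
    (hor : (pot h 2 ≤ pot h 1 ∧ pot h 1 ≤ pot h 2 + 1 ∧ pot h 1 ≤ pot h 3 + j + 1) ∨
      (pot h 1 < pot h 2 ∧ pot h 1 ≤ pot h 3 + j)) : σ.outcome h ≠ cand k 1 := by
  have hvote {s} (hs : 0 ∉ s) := outcome_ne_one_of_ballot hσ hl heven hh hd hs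
  by_cases hsincere : (pot h 2 + 1 = pot h 1 ∧ pot h 1 ≤ pot h 3 + j) ∨
      (pot h 1 ≤ pot h 2 ∧ pot h 1 + 1 ≤ pot h 3 + j)
  · have hw : wish k h.length = {0, 2} := wish_of_odd (by omega) (by omega)
    refine outcome_ne_of_wish hσ hl (by omega) (by rw [hw]; decide) (by omega)
      (heven (legal_append_wish hl (by omega)) (by simp; omega) (hd.append (by omega) _) ?_)
    rwa [pot_append_wish (by omega)]
  by_cases h12 : pot h 1 = pot h 2
  · by_cases h13 : pot h 1 = pot h 3 + j
    · have hpot := pot_append_of_odd hh (ballot k ∅)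
      refine hvote (s := ∅) (by decide) ?_ ?_ <;> grind [cand_mem_ballot]
    · have hpot := pot_append_of_odd hh (ballot k {3})
      refine hvote (s := {3}) (by decide) ?_ ?_ <;> grind [cand_mem_ballot]
  · have hpot := pot_append_of_odd hh (ballot k {2, 3})
    refine hvote (s := {2, 3}) (by decide) ?_ ?_ <;> grind [cand_mem_ballot]

theorem outcome_ne_one_of_even (hh : h.length + 2 * j = 2 * k) (hd : IsDead h)
    (hor : (pot h 2 + 1 = pot h 1 ∧ pot h 1 ≤ pot h 3 + j) ∨
      (pot h 1 ≤ pot h 2 ∧ pot h 1 + 1 ≤ pot h 3 + j)) : σ.outcome h ≠ cand k 1 := by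
  induction j generalizing h with
  | zero => exact outcome_ne_one hσ hl (r := 5) (by omega) le_rfl (by omega) (by omega)
  | succ j ih =>
    refine outcome_ne_of_legal hσ hl (by omega) fun B hB _ =>
      outcome_ne_one_of_odd hσ hB ih (by simp; omega) (hd.append (by omega) B) ?_
    have hpot := pot_append_of_even hh B
    grind

theorem outcome_ne_two_of_odd (heven : ∀ {g}, VotingRule.approval.LegalHistory g →
      g.length + 2 * j = 2 * k → pot g 0 ≤ score g (cand k 1) + (2 * k + 12) →
      (j = 0 → pot g 0 < pot g 1) →
      pot g 2 + 2 ≤ pot g 1 ∨ (pot g 2 + 1 = pot g 1 ∧ pot g 3 + j + 1 ≤ pot g 1) ∨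
        (pot g 1 ≤ pot g 2 ∧ pot g 2 ≤ pot g 1 + 1 ∧ pot g 3 + j ≤ pot g 1) →
      σ.outcome g ≠ cand k 2)
    (hh : h.length + 2 * j + 1 = 2 * k) (hd : IsDead h)
    (hor : pot h 2 + 2 ≤ pot h 1 ∨
      (pot h 2 ≤ pot h 1 ∧ pot h 1 ≤ pot h 2 + 1 ∧ pot h 3 + j + 2 ≤ pot h 1) ∨
      (pot h 2 = pot h 1 + 1 ∧ pot h 3 + j + 1 ≤ pot h 1)) : σ.outcome h ≠ cand k 2 := by
  refine outcome_ne_of_legal hσ hl (by omega) fun B hB _ => ?_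
  have hd' := hd.append (by omega) B
  have hlen : (h ++ [B]).length + 2 * j = 2 * k := by simp; omega
  refine heven hB hlen hd'.le (fun hj => lt_of_lt_of_eq hd' (pot_one_eq (by omega)).symm) ?_
  have hpot := pot_append_of_odd hh B
  grind

theorem outcome_ne_two_of_even (hh : h.length + 2 * j = 2 * k)
    (hle : pot h 0 ≤ score h (cand k 1) + (2 * k + 12)) (hlt : j = 0 → pot h 0 < pot h 1)
    (hor : pot h 2 + 2 ≤ pot h 1 ∨ (pot h 2 + 1 = pot h 1 ∧ pot h 3 + j + 1 ≤ pot h 1) ∨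
      (pot h 1 ≤ pot h 2 ∧ pot h 2 ≤ pot h 1 + 1 ∧ pot h 3 + j ≤ pot h 1)) :
    σ.outcome h ≠ cand k 2 := by
  induction j generalizing h with
  | zero => exact outcome_ne_two_at_zero hσ hl hh (hlt rfl) hor
  | succ j ih =>
    have hplace : ∀ i, h.length ≠ 2 * k + place i := fun i => by omega
    have hw : wish k h.length = {0, 1} := wish_of_even (by omega) (by omega)
    have hdead (s : Finset (Fin 4)) (hs : 1 ∈ s) : IsDead (h ++ [ballot k s]) := by
      have hscore : score (h ++ [ballot k s]) (cand k 1) = score h (cand k 1) + 1 := by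
        rw [score_append, if_pos (cand_mem_ballot.mpr hs)]
      have := pot_zero_append_le (h := h) (by omega) (ballot k s)
      rw [IsDead]
      omega
    by_cases htie : pot h 1 = pot h 2 ∧ pot h 3 + j + 1 = pot h 1
    · have hl' := legal_append (s := {0, 1, 2}) hl (by omega) fun i _ => hplace i
      have hpot := pot_append_of_even hh (ballot k {0, 1, 2})
      have he := outcome_eq_of_ne hσ hl' (i := 1) (by simp; omega) fun i hi => by
        fin_cases i
        exacts [outcome_ne_zero_of_isDead hσ hl' (by simp; omega) (hdead _ (by decide)),
          absurd rfl hi,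
          outcome_ne_two_of_odd hσ hl' ih (by simp; omega) (hdead _ (by decide))
            (by grind [cand_mem_ballot]),
          outcome_ne_three_of_le hσ hl' (by simp; omega) (by grind [cand_mem_ballot])]
      exact outcome_ne_of_notMem_wish hσ hl (by omega) hplace (by simp [hw]) (by simp [hw]) he
    · refine outcome_ne_of_wish hσ hl (by omega) (by rw [hw]; decide) (hplace 2)
        (outcome_ne_two_of_odd hσ (legal_append_wish hl (by omega)) ih (by simp; omega)
          (by rw [hw]; exact hdead _ (by decide)) ?_)
      rw [pot_append_wish (by omega)]
      omega

theorem outcome_ne_zero_of_last_pair (hh : h.length + 1 = 2 * k)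
    (hlt : pot h 0 < score h (cand k 2) + (2 * k + 12)) : σ.outcome h ≠ cand k 0 := by
  intro he
  have hw : wish k h.length = {0, 2} := wish_of_odd (by omega) (by omega)
  set g := h ++ [ballot k (wish k h.length)] with hg
  have hl' : VotingRule.approval.LegalHistory g := legal_append_wish hl (by omega)
  have hlen : g.length + 2 * 0 = 2 * k := by simpa [hg] using hh
  have hpot (i : Fin 4) : pot g i =
      score h (cand k i) + (if i ∈ ({0, 2} : Finset (Fin 4)) then 1 else 0) +
        ![12, 2 * k + 12, 2 * k + 11, 2 * k + 12] i := by
    rw [pot_eq hlen, hg, score_append, hw]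
    simp only [cand_mem_ballot, mul_zero, add_zero]
  have hpot0 : pot g 0 = pot h 0 := by rw [hg, pot_append_wish (by omega)]
  have hle (i : Fin 4) (hi : i = 1 ∨ i = 3) : pot g i ≤ pot g 0 := by
    by_contra! hlt'
    rw [hpot0, hpot] at hlt'
    refine outcome_ne_cand_of_lt hσ hl (i := i) (j := 0) (q := 0) (t := 2 * k) (by omega)
      (by omega) (.inr le_rfl) (.inl rfl) ∅ (by rintro rfl; simp at hi)
      (by clear hlt'; revert i; decide) ?_ he
    rcases hi with rfl | rfl <;> simpa [likersFrom_cand_two_mul] using hlt'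
  have hlt2 : pot g 0 < pot g 2 := by
    rw [hpot0, hpot 2]
    simp
    omega
  have he2 : σ.outcome g = cand k 2 := outcome_eq_of_ne hσ hl' (by omega) fun i hi => by
    fin_cases i
    exacts [outcome_ne_zero_of_lt hσ hl' (by omega) (by omega) (by decide) hlt2,
      outcome_ne_of_le_zero hσ hl' (by omega) (by omega) (by decide) (hle 1 (.inl rfl)),
      absurd rfl hi,
      outcome_ne_of_le_zero hσ hl' (by omega) (by omega) (by decide) (hle 3 (.inr rfl))]
  have := outcome_eq_of_wish hσ hl (by omega) (fun i => by omega) (by simp [hw]) he2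
  exact (cand k).injective.ne (by decide) (he.symm.trans this)

theorem outcome_ne_zero_of_lt_score (hh : h.length + j + 1 = 2 * k)
    (hlt : pot h 0 < score h (cand k 2) + (2 * k + 12)) : σ.outcome h ≠ cand k 0 := by
  induction j generalizing h with
  | zero => exact outcome_ne_zero_of_last_pair hσ hl hh hlt
  | succ j ih =>
    refine outcome_ne_of_legal hσ hl (by omega) fun B hB _ => ih hB (by simp; omega) ?_
    have := pot_zero_append_le (h := h) (by omega) B
    rw [score_append]
    omega

theorem outcome_eq_zero_of_pair {b : Fin 4} (hh : h.length < 2 * k)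
    (hw : wish k h.length = {0, b})
    (hpath : VotingRule.approval.LegalHistory (h ++ [ballot k {0}]) →
      σ.outcome (h ++ [ballot k {0}]) = cand k 0)
    (hdev : ∀ B, VotingRule.approval.LegalHistory (h ++ [B]) → cand k b ∈ B →
      (∀ i, i ≠ 0 → i ≠ b → cand k i ∉ B) →
      σ.outcome (h ++ [B]) ≠ cand k 0 ∧ σ.outcome (h ++ [B]) ≠ cand k b) :
    σ.outcome h = cand k 0 := by
  have hplace : ∀ i, h.length ≠ 2 * k + place i := fun i => by omega
  let x : Fin (core k).numAgents := ⟨h.length, lt_numAgents (by omega)⟩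
  have hout : (core k).network.out x = {cand k 0, cand k b} := by
    rw [out_eq (x := x) (by simp [x]; omega), hw]
    simp [ballot]
  obtain ⟨i, e⟩ := exists_outcome_eq_cand hσ hl (by omega)
  refine hσ.outcome_eq_of_out_eq_pair hl rfl hout
    (fun hself => hplace i (e ▸ congrArg Fin.val hself).symm)
    (by simpa [ballot] using hpath (legal_append hl (by omega) fun i _ => hplace i))
    fun B hB hb hsub hmem => ?_
  obtain ⟨h0, hb⟩ := hdev B (hl.append (x := x) rfl hB) hb fun i hi0 hib hi => by
    simpa [hi0, hib] using hsub hi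
  simp [h0, hb] at hmem

theorem outcome_eq_zero_of_odd (hh : h.length + 2 * j + 1 = 2 * k)
    (hscore : ∀ i, score h (cand k i) = if i = 0 then h.length else 0)
    (hpath : 1 ≤ j → VotingRule.approval.LegalHistory (h ++ [ballot k {0}]) →
      σ.outcome (h ++ [ballot k {0}]) = cand k 0) : σ.outcome h = cand k 0 := by
  have hw : wish k h.length = {0, 2} := wish_of_odd (by omega) (by omega)
  have hpot (B : Ballot (core k).numAgents) (i : Fin 4) := pot_eq (h := h ++ [B]) (j := j)
    (by simp; omega) i
  simp only [score_append, hscore] at hpot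
  rcases j.eq_zero_or_pos with rfl | hj
  · have hl' := legal_append_wish hl (by omega)
    refine outcome_eq_of_wish hσ hl (by omega) (fun i => by omega) (by simp [hw])
      (outcome_eq_of_ne hσ hl' (by simp; omega) fun i hi =>
        outcome_ne_of_le_zero hσ hl' (by simp; omega) (by simp; omega) hi ?_)
    rw [hpot, hpot, hw]
    simp only [cand_mem_ballot]
    fin_cases i <;> simp <;> omega
  · refine outcome_eq_zero_of_pair hσ hl (by omega) hw (hpath hj) fun B hB h2 hothers => ?_
    have h1 := hothers 1 (by decide) (by decide)
    have h3 := hothers 3 (by decide) (by decide)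
    constructor
    · refine outcome_ne_zero_of_lt_score hσ hB (j := 2 * j - 1) (by simp; omega) ?_
      rw [hpot, score_append, hscore]
      split_ifs <;> simp at * <;> omega
    · refine outcome_ne_two_of_even hσ hB (j := j) (by simp; omega) ?_ (by omega) ?_
      · rw [hpot, score_append, hscore]
        split_ifs <;> simp at * <;> omega
      · simp [hpot, h1, h2, h3]
        omega

theorem outcome_eq_zero (hh : h.length + 2 * j = 2 * k) (hj : 1 ≤ j)
    (hscore : ∀ i, score h (cand k i) = if i = 0 then h.length else 0) :
    σ.outcome h = cand k 0 := by
  induction j generalizing h with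
  | zero => simp at hj
  | succ j ih =>
    have hscore' {h : List (Ballot (core k).numAgents)}
        (hscore : ∀ i, score h (cand k i) = if i = 0 then h.length else 0) (i : Fin 4) :
        score (h ++ [ballot k {0}]) (cand k i) =
          if i = 0 then (h ++ [ballot k {0}]).length else 0 := by
      simp only [score_append, hscore, cand_mem_ballot, Finset.mem_singleton, List.length_append,
        List.length_singleton]
      split_ifs <;> rfl
    refine outcome_eq_zero_of_pair hσ hl (by omega) (wish_of_even (by omega) (by omega))
      (fun hl' => outcome_eq_zero_of_odd hσ hl' (j := j) (by simp; omega) (hscore' hscore)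
        fun hj hl'' => ih hl'' (by simp; omega) hj (hscore' (hscore' hscore)))
      fun B hB h1 hothers => ?_
    have h2 := hothers 2 (by decide) (by decide)
    have h3 := hothers 3 (by decide) (by decide)
    have hpot := pot_append_of_even hh B
    simp only [pot_eq hh, hscore] at hpot
    have hd : IsDead (h ++ [B]) := by
      have := hpot 0
      rw [IsDead, score_append, hscore, if_pos h1]
      split_ifs at this <;> simp at * <;> omega
    refine ⟨outcome_ne_zero_of_isDead hσ hB (by simp; omega) hd,
      outcome_ne_one_of_odd hσ hB (j := j) (outcome_ne_one_of_even hσ) (by simp; omega) hd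
        (.inl ?_)⟩
    have hpot1 := hpot 1
    have hpot2 := hpot 2
    have hpot3 := hpot 3
    simp [h1, h2, h3] at hpot1 hpot2 hpot3
    omega

end Pairs

theorem popularity_core (i : Fin 4) : (core k).popularity (2 * k + place i) =
    ![12 + 2 * k, 2 * k + 12 + k, 2 * k + 11 + k, 2 * k + 12] i := by
  have := Core.popularity_network (C := core k) (a := cand k i) (add_place_lt k i)
  rw [val_cand] at this
  rw [← this, ← Network.likersFrom_zero, likersFrom_cand (j := k) (by omega)]

theorem popularity_core_eq_zero {a : ℕ} (ha : ∀ i, a ≠ 2 * k + place i) :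
    (core k).popularity a = 0 := by
  have h0 := ha 0
  have h1 := ha 1
  have h2 := ha 2
  have h3 := ha 3
  simp only [place] at h0 h1 h2 h3
  simp only [Core.popularity, core, Nat.add_eq_zero_iff, Finset.card_eq_zero,
    Finset.filter_eq_empty_iff, Finset.mem_image, not_exists, not_and]
  refine ⟨fun x _ i _ => (ha i).symm, ?_⟩
  simp_all

theorem card_wish_le (x : ℕ) : (wish k x).card ≤ 2 := by
  unfold wish lateWish
  split_ifs
  · exact Finset.card_le_two
  · exact Finset.card_le_two
  · split <;> simp

theorem exists_network (hk : 1 ≤ k) :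
    ∃ (n : ℕ) (G : Network n) (w : Fin n), G.maxOut = 2 ∧
      (G.popularity w : ℤ) = (G.maxIn : ℤ) - (k : ℤ) ∧
      ∀ ε : ℝ, 0 < ε → ε < 1 / (2 * (n : ℝ)) →
        G.achievable .approval ε = {w} ∧ G.additiveGap .approval ε = (k : ℤ) := by
  have hconfirms (x : ℕ) : ((core k).confirms x).card = (wish k x).card :=
    Finset.card_image_of_injective _ fun i j hij => place_injective (Nat.add_left_cancel hij)
  have htop := popularity_core (k := k) 1
  refine (core k).exists_network_of_outcome_eq .approval (w := 2 * k + place 0)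
    (top := 2 * k + place 1) (y := 2 * k + 2) one_le_two (fun x _ => hconfirms x ▸ card_wish_le x)
    (by simp [core]) (by rw [hconfirms, wish_add]; rfl) (add_place_lt k 0) ?_ (add_place_lt k 1)
    (fun a _ => ?_) ?_ fun σ hσ => ?_
  · exact Finset.image_eq_empty.mpr (wish_add k 0)
  · by_cases ha : ∃ i, a = 2 * k + place i
    · obtain ⟨i, rfl⟩ := ha
      rw [htop, popularity_core]
      fin_cases i <;> simp
      omega
    · rw [popularity_core_eq_zero (not_exists.mp ha)]
      exact Nat.zero_le _
  · rw [htop, popularity_core]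
    simp
    omega
  · rw [outcome_eq_zero hσ (VotingRule.legalHistory_nil _) (j := k) (by simp) hk
      (fun i => by simp), val_cand]

end PairNetwork

/-! ### Plurality voting -/

namespace Network.IsTruthBiased

variable {n : ℕ} [NeZero n] {G : Network n} {rule : VotingRule} {σ : Profile n}
  {h : List (Ballot n)} {w b : Fin n} {m : ℕ}

theorem outcome_mem_pair_of_replicate (hσ : G.IsTruthBiased rule σ) (hl : rule.LegalHistory h)
    (hm : h.length + m ≤ n)
    (hout : ∀ x : Fin n, h.length ≤ x → x < h.length + m → G.out x = {w, b})
    (hself : ∀ x : Fin n, h.length ≤ x → x < h.length + m →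
      ∀ h', rule.LegalHistory h' → h'.length = x → σ.outcome h' ≠ x)
    (ho : σ.outcome (h ++ List.replicate m {b}) ∈ ({w, b} : Finset (Fin n))) :
    σ.outcome h ∈ ({w, b} : Finset (Fin n)) := by
  induction m generalizing h with
  | zero => simpa only [List.replicate_zero, List.append_nil] using ho
  | succ m ih =>
    let x : Fin n := ⟨h.length, by omega⟩
    have hx : G.out x = {w, b} := hout x le_rfl (by simp [x])
    have hleg : rule.Legal x {b} := rule.legal_singleton (G.ne_of_mem_out (by simp [hx]))
    have hstep := ih (hl.append (x := x) rfl hleg) (by simp; omega)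
      (fun y h1 h2 => hout y (by simp at h1; omega) (by simp at h2; omega))
      (fun y h1 h2 => hself y (by simp at h1; omega) (by simp at h2; omega))
      (by simpa only [List.append_assoc, List.singleton_append, ← List.replicate_succ] using ho)
    rw [← hx] at hstep ⊢
    exact hσ.outcome_mem_out hl rfl hleg hstep (hself x le_rfl (by simp [x]) h hl rfl)

end Network.IsTruthBiased

namespace Profile

variable {n : ℕ} {σ : Profile n} {h : List (Ballot n)} {m : ℕ} {a b : Fin n}

theorem score_steps_add_score_steps_le (hσ : VotingRule.plurality.LegalProfile σ)
    (hl : VotingRule.plurality.LegalHistory h) (hm : h.length + m ≤ n) (hab : a ≠ b) :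
    score (σ.steps m h) a + score (σ.steps m h) b ≤ score h a + score h b + m := by
  induction m generalizing h with
  | zero => exact le_rfl
  | succ m ih =>
    have hh : h.length < n := by omega
    have hleg := hσ h hh hl
    have hone : (if a ∈ σ h then 1 else 0) + (if b ∈ σ h then 1 else 0) ≤ 1 := by
      have := Finset.card_le_one.mp hleg.2 a
      grind
    have := ih (hl.append (x := ⟨_, hh⟩) rfl hleg) (by simp; omega)
    rw [steps]
    simp only [score_append] at this
    omega

end Profile

namespace BlockNetwork

/-- The place of the candidate `l` in the order of the agents: the candidates `k + 1, k, …, 0`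
follow, in this order, the `k * (k + 1)` agents of the blocks. Candidate `k + 1` is going to be
elected. -/
def place (k l : ℕ) : ℕ := k * (k + 1) + (k + 1 - l)

theorem div_lt_of_lt_mul {k x : ℕ} (hx : x < k * (k + 1)) : x / (k + 1) < k :=
  Nat.div_lt_of_lt_mul (by rwa [mul_comm])

/-- The first agents form blocks, numbered `0, …, k - 1`, of `k + 1` agents each. The members of
the block `i` confirm the candidates `k + 1` and `i`; every candidate `l` with `0 < l ≤ k` confirms
the candidate `l - 1`. The numbers of fans are such that the candidate `k + 1` is as popular as the
candidate `k`, and the candidate `l ≤ k` is more popular than the candidate `k` by `k - l`. -/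
def core (k : ℕ) : Core where
  size := k * (k + 1) + (k + 2)
  size_pos := by omega
  confirms x := if x < k * (k + 1) then {k * (k + 1), place k (x / (k + 1))}
    else if k * (k + 1) < x ∧ x < k * (k + 1) + (k + 1) then {x + 1} else ∅
  confirms_lt x _ a ha := by
    unfold place at ha
    generalize x / (k + 1) = i at ha
    split_ifs at ha <;>
      simp only [Finset.mem_insert, Finset.mem_singleton, Finset.notMem_empty] at ha <;>
      omega
  not_mem_self x _ := by
    unfold place
    split_ifs with h
    · have := div_lt_of_lt_mul h
      simp only [Finset.mem_insert, Finset.mem_singleton]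
      omega
    all_goals simp
  maxFans := k * (k + 1) + (k + 4)
  fans a := if a = k * (k + 1) then k + 4 else if a = k * (k + 1) + 1 then k * (k + 1) + (k + 4)
    else if k * (k + 1) < a ∧ a < k * (k + 1) + (k + 2) then a + 1 else 0
  fans_le a := by split_ifs <;> omega

variable {k : ℕ}

theorem place_lt (k l : ℕ) : place k l < (core k).size := by
  simp only [place, core]
  omega

/-- The candidates `0, …, k + 1`; larger indices stand for the candidate `k + 1`. -/
def cand (k l : ℕ) : Fin (core k).numAgents :=
  ⟨place k l, (place_lt k l).trans_le (core k).size_le_numAgents⟩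

theorem val_cand (k l : ℕ) : (cand k l : ℕ) = k * (k + 1) + (k + 1 - l) := rfl

theorem cand_inj {l m : ℕ} (hl : l ≤ k + 1) (hm : m ≤ k + 1) : cand k l = cand k m ↔ l = m := by
  rw [Fin.ext_iff, val_cand, val_cand]
  omega

theorem cand_lt_cand {l m : ℕ} (hl : l ≤ k + 1) : cand k l < cand k m ↔ m < l := by
  rw [Fin.lt_def, val_cand, val_cand]
  omega

theorem cand_mem_out {x : Fin (core k).numAgents} (hx : (x : ℕ) < (core k).size) {l : ℕ}
    (hl : l ≤ k + 1) : cand k l ∈ (core k).network.out x ↔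
      ((x : ℕ) < k * (k + 1) ∧ (l = k + 1 ∨ l = x / (k + 1))) ∨ (l < k ∧ x = cand k (l + 1)) := by
  rw [Core.mem_out_of_lt hx, Fin.ext_iff, val_cand, val_cand]
  simp only [core, place] at hx ⊢
  split_ifs with h1 h2
  · have := div_lt_of_lt_mul h1
    simp only [Finset.mem_insert, Finset.mem_singleton]
    omega
  · rw [Finset.mem_singleton]
    omega
  · simp only [Finset.notMem_empty, false_iff]
    omega

theorem out_eq_pair {x : Fin (core k).numAgents} (hx : (x : ℕ) < k * (k + 1)) :
    (core k).network.out x = {cand k (k + 1), cand k (x / (k + 1))} := by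
  refine Core.out_eq_of_confirms_eq (by simp only [core]; omega) ?_
  simp only [Finset.map_insert, Finset.map_singleton, Fin.valEmbedding_apply, val_cand]
  simp [core, hx, place]

theorem out_cand {l : ℕ} (hl : l < k) :
    (core k).network.out (cand k (l + 1)) = {cand k l} := by
  refine Core.out_eq_of_confirms_eq (place_lt k _) ?_
  rw [Finset.map_singleton, Fin.valEmbedding_apply, val_cand, val_cand]
  simp only [core]
  rw [if_neg (by omega), if_pos (by omega), Finset.singleton_inj]
  omega

theorem likersFrom_eq {l t : ℕ} (hl : l ≤ k + 1) (ht : t ≤ (core k).size) :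
    (core k).network.likersFrom t (cand k l) =
      ((Finset.Ico t (core k).size).filter fun x =>
        (x < k * (k + 1) ∧ (l = k + 1 ∨ l = x / (k + 1))) ∨ (l < k ∧ x = place k (l + 1))).card +
          (core k).fans (cand k l) := by
  rw [Core.likersFrom_eq ht (place_lt k l)]
  congr 2
  refine Finset.filter_congr fun x hx => ?_
  have hx' := (Finset.mem_Ico.mp hx).2
  have := cand_mem_out (x := ⟨x, hx'.trans_le (core k).size_le_numAgents⟩) hx' hl
  rwa [Core.mem_out_of_lt hx', Fin.ext_iff] at this

theorem likersFrom_elect_add {t : ℕ} (ht : t ≤ k * (k + 1)) :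
    (core k).network.likersFrom t (cand k (k + 1)) + t = k * (k + 1) + (k + 4) := by
  have hfilter : ((Finset.Ico t (core k).size).filter fun x => (x < k * (k + 1) ∧
      (k + 1 = k + 1 ∨ k + 1 = x / (k + 1))) ∨ (k + 1 < k ∧ x = place k (k + 1 + 1))) =
      Finset.Ico t (k * (k + 1)) := by
    ext x
    rw [Finset.mem_filter, Finset.mem_Ico, Finset.mem_Ico]
    simp only [core, true_or, and_true]
    omega
  have hfans : (core k).fans (cand k (k + 1)) = k + 4 := by simp [core, val_cand]
  rw [likersFrom_eq le_rfl (by simp only [core]; omega), hfilter, Nat.card_Ico, hfans]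
  omega

theorem likersFrom_cand_self {t : ℕ} (ht : t ≤ k * (k + 1)) :
    (core k).network.likersFrom t (cand k k) = k * (k + 1) + (k + 4) := by
  have hfilter : ((Finset.Ico t (core k).size).filter fun x => (x < k * (k + 1) ∧
      (k = k + 1 ∨ k = x / (k + 1))) ∨ (k < k ∧ x = place k (k + 1))) = ∅ := by
    rw [Finset.filter_eq_empty_iff]
    intro x _
    have := div_lt_of_lt_mul (k := k) (x := x)
    omega
  have hfans : (core k).fans (cand k k) = k * (k + 1) + (k + 4) := by simp [core, val_cand]
  rw [likersFrom_eq (by omega) (by simp only [core]; omega), hfilter, hfans, Finset.card_empty,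
    zero_add]

theorem fans_cand {l : ℕ} (hl : l < k) :
    (core k).fans (cand k l) + l = k * (k + 1) + (k + 2) := by
  simp only [core, val_cand]
  rw [if_neg (by omega), if_neg (by omega), if_pos (by omega)]
  omega

theorem likersFrom_cand_of_lt {l j : ℕ} (hlj : l < j) (hjk : j ≤ k) :
    (core k).network.likersFrom (j * (k + 1)) (cand k l) + l = k * (k + 1) + (k + 3) := by
  have hj : j * (k + 1) ≤ k * (k + 1) := Nat.mul_le_mul_right _ hjk
  have hfilter : ((Finset.Ico (j * (k + 1)) (core k).size).filter fun x => (x < k * (k + 1) ∧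
      (l = k + 1 ∨ l = x / (k + 1))) ∨ (l < k ∧ x = place k (l + 1))) = {place k (l + 1)} := by
    ext x
    have := (Nat.le_div_iff_mul_le (k := k + 1) (x := j) (y := x) (by omega))
    rw [Finset.mem_filter, Finset.mem_Ico, Finset.mem_singleton]
    simp only [core, place]
    omega
  rw [likersFrom_eq (by omega) (by simp only [core]; omega), hfilter, Finset.card_singleton]
  have := fans_cand (hlj.trans_le hjk)
  omega

theorem likersFrom_cand_of_le {l j : ℕ} (hjl : j ≤ l) (hl : l < k) :
    (core k).network.likersFrom (j * (k + 1)) (cand k l) + l = k * (k + 1) + (2 * k + 4) := by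
  have hj : j * (k + 1) ≤ l * (k + 1) := Nat.mul_le_mul_right _ hjl
  have hlk : (l + 1) * (k + 1) ≤ k * (k + 1) := Nat.mul_le_mul_right _ hl
  rw [Nat.succ_mul] at hlk
  have hfilter : ((Finset.Ico (j * (k + 1)) (core k).size).filter fun x => (x < k * (k + 1) ∧
      (l = k + 1 ∨ l = x / (k + 1))) ∨ (l < k ∧ x = place k (l + 1))) =
      insert (place k (l + 1)) (Finset.Ico (l * (k + 1)) (l * (k + 1) + (k + 1))) := by
    ext x
    have hdiv : l = x / (k + 1) ↔ l * (k + 1) ≤ x ∧ x < l * (k + 1) + (k + 1) := by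
      rw [eq_comm, Nat.div_eq_iff (by omega)]
      omega
    rw [Finset.mem_filter, Finset.mem_Ico, Finset.mem_insert, Finset.mem_Ico, hdiv]
    simp only [core, place]
    omega
  rw [likersFrom_eq (by omega) (by simp only [core]; omega), hfilter,
    Finset.card_insert_of_notMem (by simp only [place, Finset.mem_Ico]; omega), Nat.card_Ico]
  have := fans_cand hl
  omega

section Equilibrium

variable {rule : VotingRule} {σ : Profile (core k).numAgents}
  {h : List (Ballot (core k).numAgents)} {x : Fin (core k).numAgents} {i j l m t : ℕ}

/-- The potential of the candidate `l`. -/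
def pot (h : List (Ballot (core k).numAgents)) (l : ℕ) : ℕ :=
  (core k).network.potential h (cand k l)

theorem pot_add_of_lt (hh : h.length = j * (k + 1)) (hlj : l < j) (hjk : j ≤ k) :
    pot h l + l = score h (cand k l) + (k * (k + 1) + (k + 3)) := by
  have := likersFrom_cand_of_lt hlj hjk
  rw [pot, Network.potential, hh]
  omega

theorem pot_add_of_le (hh : h.length = j * (k + 1)) (hjl : j ≤ l) (hlk : l ≤ k) :
    pot h l + l = score h (cand k l) + (k * (k + 1) + (2 * k + 4)) := by
  rw [pot, Network.potential, hh]
  rcases hlk.lt_or_eq with hlk | rfl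
  · have := likersFrom_cand_of_le hjl hlk
    omega
  · rw [likersFrom_cand_self (Nat.mul_le_mul_right _ hjl)]
    omega

theorem le_pot_self (hh : h.length ≤ k * (k + 1)) : k * (k + 1) + (k + 4) ≤ pot h k := by
  rw [pot, Network.potential, likersFrom_cand_self hh]
  exact Nat.le_add_left _ _

theorem pot_elect_add (hh : h.length ≤ k * (k + 1)) :
    pot h (k + 1) + h.length = score h (cand k (k + 1)) + (k * (k + 1) + (k + 4)) := by
  have := likersFrom_elect_add hh
  rw [pot, Network.potential]
  omega

theorem le_of_fans_pos {a : ℕ} (ha : 0 < (core k).fans a) : k * (k + 1) ≤ a := by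
  simp only [core] at ha
  split_ifs at ha <;> omega

theorem lt_size_of_le {y : ℕ} (hy : y ≤ k * (k + 1)) : y < (core k).size := by
  simp only [core]
  omega

theorem pot_append (hh : h.length < k * (k + 1)) (B : Ballot (core k).numAgents) (hl : l ≤ k + 1) :
    pot (h ++ [B]) l + (if l = k + 1 ∨ l = h.length / (k + 1) then 1 else 0) =
      pot h l + if cand k l ∈ B then 1 else 0 := by
  let x : Fin (core k).numAgents :=
    ⟨h.length, (lt_size_of_le hh.le).trans_le (core k).size_le_numAgents⟩
  have hne : ¬(l < k ∧ x = cand k (l + 1)) := by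
    rintro ⟨-, e⟩
    have := congrArg Fin.val e
    rw [val_cand] at this
    simp only [x] at this
    omega
  have hmem := cand_mem_out (x := x) (lt_size_of_le hh.le) hl
  rw [or_iff_left hne, and_iff_right hh] at hmem
  have := Network.potential_append (G := (core k).network) (x := x) rfl B (cand k l)
  simpa only [pot, hmem] using this

theorem pot_append_replicate_add {r : ℕ} (hh : h.length = i * (k + 1)) (hi : i < k)
    (hr : r ≤ k + 1) (hl : l ≤ k + 1) :
    pot (h ++ List.replicate r {cand k i}) l + (if l = k + 1 then r else 0) = pot h l := by
  have hik : (i + 1) * (k + 1) ≤ k * (k + 1) := Nat.mul_le_mul_right _ hi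
  rw [Nat.succ_mul] at hik
  induction r with
  | zero => simp
  | succ r ih =>
    have hlen : (h ++ List.replicate r {cand k i}).length = i * (k + 1) + r := by simp [hh]
    have hdiv : (i * (k + 1) + r) / (k + 1) = i := by
      rw [Nat.div_eq_iff (by omega)]
      omega
    have hstep := pot_append (h := h ++ List.replicate r {cand k i}) (by omega) {cand k i} hl
    simp only [hlen, hdiv, Finset.mem_singleton, cand_inj hl (by omega : i ≤ k + 1)] at hstep
    rw [List.replicate_succ', ← List.append_assoc]
    have hr := ih (by omega)
    by_cases hl : l = k + 1
    · simp only [hl, if_true, true_or] at hstep hr ⊢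
      rw [if_neg (by omega)] at hstep
      omega
    · simp only [hl, if_false, false_or] at hstep hr ⊢
      omega

theorem pot_append_replicate (hh : h.length = i * (k + 1)) (hi : i < k) (hl : l ≤ k) :
    pot (h ++ List.replicate (k + 1) {cand k i}) l = pot h l := by
  simpa only [if_neg (by omega : l ≠ k + 1), add_zero] using
    pot_append_replicate_add hh hi le_rfl (by omega : l ≤ k + 1)

theorem length_append_replicate (hh : h.length = i * (k + 1)) (a : Fin (core k).numAgents) :
    (h ++ List.replicate (k + 1) {a}).length = (i + 1) * (k + 1) := by
  rw [List.length_append, List.length_replicate, hh, Nat.succ_mul]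

/-- No member of a block who has yet to vote confirms the candidate `l`. -/
def IsSettled (h : List (Ballot (core k).numAgents)) (l : ℕ) : Prop :=
  ∀ x, h.length ≤ x → x < k * (k + 1) → l ≠ k + 1 ∧ l ≠ x / (k + 1)

theorem isSettled_self (h : List (Ballot (core k).numAgents)) : IsSettled h k := fun x _ hx =>
  ⟨by omega, (div_lt_of_lt_mul hx).ne'⟩

theorem isSettled_of_lt (hh : h.length = j * (k + 1)) (hjk : j ≤ k) (hlj : l < j) :
    IsSettled h l := fun x hjx _ =>
  ⟨by omega, (hlj.trans_le ((Nat.le_div_iff_mul_le k.succ_pos).mpr (hh ▸ hjx))).ne⟩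

theorem isSettled_of_le (hh : k * (k + 1) ≤ h.length) : IsSettled h l := fun _ hx hx' =>
  absurd (hh.trans hx) hx'.not_ge

theorem uninterested_of_lt (hx : (x : ℕ) < k * (k + 1)) (hmk : m ≤ k) (hm : m ≠ x / (k + 1)) :
    (core k).network.Uninterested x (cand k m) := by
  refine ⟨fun e => ?_, ?_⟩
  · rw [← e, val_cand] at hx
    omega
  · rw [cand_mem_out (by simp only [core]; omega) (by omega)]
    rintro (⟨-, e | e⟩ | ⟨-, e⟩)
    · omega
    · exact hm e
    · rw [e, val_cand] at hx
      omega

section Play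

variable (hσ : (core k).network.IsTruthBiased rule σ) (hleg : rule.LegalHistory h)

include hσ hleg

theorem exists_outcome_eq_cand (hh : h.length ≤ (core k).size) :
    ∃ l ≤ k + 1, σ.outcome h = cand k l := by
  obtain ⟨hlt, hpos⟩ := Core.outcome_lt_size_and_fans_pos hσ hleg hh (a := cand k k)
    (place_lt k k) (by rw [val_cand]; simp [core]; omega)
  have hW := le_of_fans_pos hpos
  have hsize : (σ.outcome h : ℕ) < k * (k + 1) + (k + 2) := hlt
  refine ⟨k * (k + 1) + (k + 1) - σ.outcome h, by omega, Fin.ext ?_⟩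
  rw [val_cand]
  omega

theorem outcome_ne_cand_of_pot_lt {e : ℕ} (hh : h.length ≤ (core k).size) (hlk : l ≤ k + 1)
    (hmk : m ≤ k + 1) (hlm : l ≠ m) (hl : IsSettled h l)
    (he : m = l + 1 → l < k → place k m < h.length ∨ 1 ≤ e)
    (hlt : pot h m + e < pot h l + if m < l then 1 else 0) : σ.outcome h ≠ cand k m := by
  let exceptions : Finset (Fin (core k).numAgents) := if 1 ≤ e then {cand k m} else ∅
  have hcard : exceptions.card ≤ e := by
    unfold exceptions
    split_ifs with h1 <;> simp [h1]
  refine hσ.outcome_ne_of_lt hleg le_rfl (hh.trans (core k).size_le_numAgents) exceptions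
    (a := cand k l) (fun x hhx hlx hxe => ?_) ?_
  swap
  · simp only [cand_lt_cand hlk]
    exact (Nat.add_le_add_left hcard _).trans_lt hlt
  rcases le_or_gt (core k).size (x : ℕ) with hx | hx
  · exact ⟨Core.committed_of_le hx hlx, Core.uninterested_of_le hx hlx (place_lt k m)
      fun e => hlm ((cand_inj hmk hlk).mp e).symm⟩
  obtain ⟨hxW, hlx'⟩ | ⟨hlk', rfl⟩ := (cand_mem_out hx hlk).mp hlx
  · exact (hlx'.elim (hl x hhx hxW).1 (hl x hhx hxW).2).elim
  · have hout := out_cand hlk'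
    refine ⟨?_, fun e => ?_, ?_⟩
    · cases rule
      exacts [hout, hlx]
    · obtain rfl := (cand_inj hmk (by omega)).mp e
      have h1 := (he rfl hlk').resolve_left hhx.not_gt
      exact hxe (by simp [exceptions, h1])
    · rw [hout, Finset.mem_singleton]
      exact fun e => hlm ((cand_inj hmk hlk).mp e).symm

theorem outcome_ne_elect (hh : h.length ≤ k * (k + 1))
    (hlt : pot h (k + 1) < k * (k + 1) + (k + 4)) : σ.outcome h ≠ cand k (k + 1) :=
  outcome_ne_cand_of_pot_lt hσ hleg (e := 0) (lt_size_of_le hh).le (by omega) le_rfl (by omega)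
    (isSettled_self h) (fun _ hk => absurd hk (lt_irrefl k)) (by have := le_pot_self hh; omega)

end Play

theorem block_lt {x : ℕ} (hj : j < k) (hx : x < j * (k + 1) + (k + 1)) : x < k * (k + 1) := by
  rw [← Nat.succ_mul] at hx
  exact hx.trans_le (Nat.mul_le_mul_right _ hj)

theorem block_le_numAgents (hj : j < k) : j * (k + 1) + (k + 1) ≤ (core k).numAgents :=
  (lt_size_of_le (block_lt hj (Nat.lt_succ_self _)).le).trans_le (core k).size_le_numAgents

theorem div_eq_of_mem_block {x : ℕ} (h1 : j * (k + 1) ≤ x) (h2 : x < j * (k + 1) + (k + 1)) :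
    x / (k + 1) = j := by
  rw [Nat.div_eq_iff (by omega)]
  omega

theorem uninterested_of_isSettled (hi : i ≤ k) (hsettled : IsSettled h i) (hx : h.length ≤ x)
    (hxi : (x : ℕ) < place k (i + 1)) : (core k).network.Uninterested x (cand k i) := by
  refine ⟨fun e => ?_, fun hmem => ?_⟩
  · rw [← e, val_cand, place] at hxi
    omega
  · obtain ⟨hxW, hx'⟩ | ⟨-, rfl⟩ :=
      (cand_mem_out (hxi.trans (place_lt k (i + 1))) (by omega)).mp hmem
    · exact hx'.elim (hsettled x hx hxW).1 (hsettled x hx hxW).2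
    · exact lt_irrefl _ hxi

theorem legalHistory_append_replicate (hleg : rule.LegalHistory h) (l : ℕ) {r : ℕ}
    (hr : h.length + r ≤ k * (k + 1)) :
    rule.LegalHistory (h ++ List.replicate r {cand k l}) := by
  induction r with
  | zero => simpa only [List.replicate_zero, List.append_nil] using hleg
  | succ r ih =>
    have hlen : (h ++ List.replicate r {cand k l}).length < k * (k + 1) := by
      rw [List.length_append, List.length_replicate]
      omega
    rw [List.replicate_succ', ← List.append_assoc]
    refine (ih (by omega)).append
      (x := ⟨_, (lt_size_of_le hlen.le).trans_le (core k).size_le_numAgents⟩) rfl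
      (rule.legal_singleton fun e => ?_)
    have := congrArg Fin.val e
    rw [val_cand] at this
    simp only at this
    omega

section Rivals

variable (hσ : (core k).network.IsTruthBiased rule σ) (hleg : rule.LegalHistory h)

include hσ hleg

theorem pot_steps_eq (hh : h.length = j * (k + 1)) (hj : j < k) (hm : m ≤ k) (hmj : m ≠ j)
    (ho : σ.outcome h = cand k m) (hl : l ≤ k) (hlj : l ≠ j) :
    pot (σ.steps (k + 1) h) l = pot h l := by
  have hmn : h.length + (k + 1) ≤ (core k).numAgents := hh ▸ block_le_numAgents hj
  have hdiv (x : ℕ) (h1 : h.length ≤ x) (h2 : x < h.length + (k + 1)) :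
      x < k * (k + 1) ∧ x / (k + 1) = j := by
    rw [hh] at h1 h2
    exact ⟨block_lt hj h2, div_eq_of_mem_block h1 h2⟩
  refine le_antisymm (hσ.potential_steps_le hleg hmn fun x h1 h2 _ _ => ?_)
    (hσ.potential_le_steps_add hleg hmn ∅ fun x h1 h2 hx _ => ?_)
  · obtain ⟨hxW, hxj⟩ := hdiv x h1 h2
    exact ho ▸ uninterested_of_lt hxW hm (by rwa [hxj])
  · obtain ⟨hxW, hxj⟩ := hdiv x h1 h2
    exact absurd hx (uninterested_of_lt hxW hl (by rwa [hxj])).2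

theorem outcome_mem_of_append_replicate (hh : h.length = j * (k + 1)) (hj : j < k)
    (ho : σ.outcome (h ++ List.replicate (k + 1) {cand k j}) ∈
      ({cand k (k + 1), cand k j} : Finset _)) :
    σ.outcome h ∈ ({cand k (k + 1), cand k j} : Finset _) := by
  refine hσ.outcome_mem_pair_of_replicate hleg (hh ▸ block_le_numAgents hj) (fun x h1 h2 => ?_)
    (fun x _ h2 h' hleg' hlen e => ?_) ho
  · rw [hh] at h1 h2
    rw [out_eq_pair (block_lt hj h2), div_eq_of_mem_block h1 h2]
  · have hxW := block_lt hj (hh ▸ h2)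
    obtain ⟨l, -, hl⟩ := exists_outcome_eq_cand hσ hleg' (hlen ▸ (lt_size_of_le hxW.le).le)
    rw [← e, hl, val_cand] at hxW
    omega

/-- The candidate `i + 1`, whose turn it is, can abstain and then beats everybody. -/
theorem outcome_ne_cand_of_length_eq_place (hh : h.length = place k (i + 1)) (hi : i < k)
    (hpot : pot h i ≤ pot h (i + 1) + 1)
    (hother : ∀ l ≤ k + 1, l ≠ i → l ≠ i + 1 → pot h l < pot h (i + 1)) :
    σ.outcome h ≠ cand k i := by
  have hlegal := rule.legal_empty (cand k (i + 1))
  have hleg' := hleg.append hh hlegal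
  have hlen : (h ++ [(∅ : Ballot (core k).numAgents)]).length = place k (i + 1) + 1 := by simp [hh]
  have happend (l : ℕ) (hl : l ≤ k + 1) :
      pot (h ++ [∅]) l + (if l = i then 1 else 0) = pot h l := by
    have := Network.potential_append (G := (core k).network) (x := cand k (i + 1)) hh ∅ (cand k l)
    simpa only [pot, out_cand hi, Finset.mem_singleton, cand_inj hl (by omega : i ≤ k + 1),
      Finset.notMem_empty, if_false, add_zero] using this
  have hself : σ.outcome (h ++ [∅]) = cand k (i + 1) := by
    have hsize : (h ++ [(∅ : Ballot (core k).numAgents)]).length ≤ (core k).size :=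
      hlen ▸ place_lt k (i + 1)
    obtain ⟨m, hm, ho⟩ := exists_outcome_eq_cand hσ hleg' hsize
    by_cases hmi : m = i + 1
    · rw [ho, hmi]
    refine absurd ho (outcome_ne_cand_of_pot_lt hσ hleg' (e := 0) (l := i + 1) hsize (by omega) hm
      (Ne.symm hmi) (isSettled_of_le ?_) (fun hm' _ => .inl ?_) ?_)
    · rw [hlen, place]
      omega
    · rw [hlen, place, place]
      omega
    · have h1 := happend m hm
      have h2 := happend (i + 1) (by omega)
      rw [if_neg (by omega)] at h2
      rcases eq_or_ne m i with rfl | hmi'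
      · rw [if_pos rfl] at h1
        rw [if_pos (Nat.lt_succ_self m)]
        omega
      · have h3 := hother m hm hmi' hmi
        omega
  rw [hσ.outcome_eq_self hleg hh hlegal hself]
  exact fun e => absurd ((cand_inj (by omega) (by omega)).mp e) (by omega)

theorem outcome_ne_cand_of_isSettled (hh : h.length ≤ k * (k + 1)) (hi : i < k)
    (hsettled : IsSettled h i) (hsettled' : IsSettled h (i + 1))
    (hpot : pot h i ≤ pot h (i + 1) + 1)
    (hother : ∀ l ≤ k + 1, l ≠ i → l ≠ i + 1 → pot h l < pot h (i + 1)) :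
    σ.outcome h ≠ cand k i := by
  intro ho
  obtain ⟨r, hr⟩ := Nat.exists_eq_add_of_le (hh.trans (Nat.le_add_right _ _) :
    h.length ≤ place k (i + 1))
  have hrn : h.length + r ≤ (core k).numAgents :=
    hr ▸ (place_lt k (i + 1)).le.trans (core k).size_le_numAgents
  have huninterested (x : Fin (core k).numAgents) (hx : h.length ≤ x) (hxr : x < h.length + r) :
      (core k).network.Uninterested x (σ.outcome h) :=
    ho ▸ uninterested_of_isSettled hi.le hsettled hx (hr ▸ hxr)
  have hle (l : ℕ) : pot (σ.steps r h) l ≤ pot h l :=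
    hσ.potential_steps_le hleg hrn fun x h1 h2 _ _ => huninterested x h1 h2
  have hge : pot h (i + 1) ≤ pot (σ.steps r h) (i + 1) := by
    refine hσ.potential_le_steps_add hleg hrn ∅ fun x h1 h2 hmem _ =>
      ⟨?_, huninterested x h1 h2⟩
    obtain ⟨hxW, hx'⟩ | ⟨hik, rfl⟩ :=
      (cand_mem_out ((hr ▸ h2).trans (place_lt k (i + 1))) (by omega)).mp hmem
    · exact (hx'.elim (hsettled' x h1 hxW).1 (hsettled' x h1 hxW).2).elim
    · cases rule
      exacts [out_cand hik, hmem]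
  refine outcome_ne_cand_of_length_eq_place hσ (hleg.steps hσ.legal hrn) ?_ hi ?_ ?_
    (σ.outcome_steps hrn ▸ ho)
  · rw [Profile.length_steps, hr]
  · exact (hle i).trans (hpot.trans (Nat.add_le_add_right hge 1))
  · exact fun l hl hli hli' => (hle l).trans_lt ((hother l hl hli hli').trans_le hge)

theorem outcome_mem_of_forall_exists_pot_lt (hh : h.length = j * (k + 1)) (hij : i < j) (hj : j < k)
    (hle : ∀ q ≤ i, pot h q ≤ pot h j)
    (hlt : ∀ l, i < l → l ≤ k → l ≠ j → ∃ q ≤ i, pot h l < pot h q)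
    (hne : ∀ q ≤ i, σ.outcome (h ++ List.replicate (k + 1) {cand k j}) ≠ cand k q) :
    σ.outcome h ∈ ({cand k (k + 1), cand k j} : Finset _) := by
  refine outcome_mem_of_append_replicate hσ hleg hh hj ?_
  have hlen := length_append_replicate hh (cand k j)
  have hW : (j + 1) * (k + 1) ≤ k * (k + 1) := Nat.mul_le_mul_right _ hj
  have hleg' := legalHistory_append_replicate hleg j (r := k + 1)
    (by rw [hh, ← Nat.succ_mul]; exact hW)
  have hsize := (lt_size_of_le (hlen ▸ hW)).le
  obtain ⟨m, hm, ho⟩ := exists_outcome_eq_cand hσ hleg' hsize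
  rw [Finset.mem_insert, Finset.mem_singleton]
  by_contra! hnot
  have hmk : m ≠ k + 1 := fun e => hnot.1 (e ▸ ho)
  have hmj : m ≠ j := fun e => hnot.2 (e ▸ ho)
  have him : i < m := not_le.mp fun hmi => hne m hmi ho
  obtain ⟨q, hq, hmq⟩ := hlt m him (by omega) hmj
  have hqj := hle q hq
  rw [← pot_append_replicate hh hj (by omega), ← pot_append_replicate hh hj (by omega)] at hmq hqj
  by_cases hm' : m = j + 1
  · exact outcome_ne_cand_of_pot_lt hσ hleg' (e := 0) (l := q) hsize (by omega) hm (by omega)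
      (isSettled_of_lt hlen hj (by omega)) (by omega) (by omega) ho
  · exact outcome_ne_cand_of_pot_lt hσ hleg' (e := 0) (l := j) hsize (by omega) hm hmj.symm
      (isSettled_of_lt hlen hj (by omega)) (fun e => absurd e hm') (by omega) ho

/-- A settled candidate `l` beats the candidates `q ≤ i`. As long as no such `l` is settled, its
block elects `l` or the candidate `k + 1` by voting for `l`, so it does not let `q` win. -/
theorem outcome_ne_cand_of_forall_pot_le (hh : h.length = j * (k + 1)) (hij : i < j) (hj : j ≤ k)
    (hil : i < l) (hlk : l ≤ k) (hle : ∀ q ≤ i, pot h q ≤ pot h l) :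
    ∀ q ≤ i, σ.outcome h ≠ cand k q := by
  have hW : h.length ≤ k * (k + 1) := hh ▸ Nat.mul_le_mul_right _ hj
  induction hd : k - j generalizing h j l with
  | zero =>
    intro q hq
    have := hle q hq
    exact outcome_ne_cand_of_pot_lt hσ hleg (e := 0) (l := l) (lt_size_of_le hW).le (by omega)
      (by omega) (by omega) (isSettled_of_le (hh ▸ Nat.mul_le_mul_right _ (by omega))) (by omega)
      (by rw [if_pos (by omega)]; omega)
  | succ d ih =>
    have hjk : j < k := by omega
    have hW' : (j + 1) * (k + 1) ≤ k * (k + 1) := Nat.mul_le_mul_right _ hjk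
    have hjk1 : h.length + (k + 1) = (j + 1) * (k + 1) := by rw [hh, Nat.succ_mul]
    intro q hq ho
    by_cases hother : ∃ m, i < m ∧ m ≤ k ∧ m ≠ j ∧ ∀ q ≤ i, pot h q ≤ pot h m
    · obtain ⟨m, him, hmk, hmj, hm⟩ := hother
      have hsteps (a : ℕ) (ha : a ≤ k) (haj : a ≠ j) : pot (σ.steps (k + 1) h) a = pot h a :=
        pot_steps_eq hσ hleg hh hjk (m := q) (by omega) (by omega) ho ha haj
      have hn : h.length + (k + 1) ≤ (core k).numAgents := hh ▸ block_le_numAgents hjk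
      have hlen := (σ.length_steps (k + 1) h).trans hjk1
      refine ih (hleg.steps hσ.legal hn) hlen (by omega) hjk him hmk (fun q' hq' => ?_)
        (hlen.trans_le hW') (by omega) q hq (σ.outcome_steps hn ▸ ho)
      rw [hsteps q' (by omega) (by omega), hsteps m hmk hmj]
      exact hm q' hq'
    · obtain rfl : l = j := by
        by_contra hlj
        exact hother ⟨l, hil, hlk, hlj, hle⟩
      push Not at hother
      have hpot (a : ℕ) (ha : a ≤ k) := pot_append_replicate hh hjk ha
      have hlen := length_append_replicate hh (cand k l)
      have hmem := outcome_mem_of_forall_exists_pot_lt hσ hleg hh hil hjk hle hother <|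
        ih (legalHistory_append_replicate hleg l (hjk1.trans_le hW')) hlen (by omega) hjk hil hlk
          (fun q hq => by rw [hpot q (by omega), hpot l hlk]; exact hle q hq) (by rwa [hlen])
          (by omega)
      rw [ho, Finset.mem_insert, Finset.mem_singleton, cand_inj (by omega) le_rfl,
        cand_inj (by omega) (by omega)] at hmem
      omega

/-- The next block, if there is one, elects the candidate `i + 1` or the candidate `k + 1`: once
its members have voted for `i + 1`, this candidate is settled. -/
theorem outcome_ne_cand_of_pot_eq_add_one (hh : h.length = (i + 1) * (k + 1)) (hi : i < k)
    (hpot : pot h i = pot h (i + 1) + 1)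
    (hother : ∀ l ≤ k + 1, l ≠ i → l ≠ i + 1 → pot h l < pot h (i + 1)) :
    σ.outcome h ≠ cand k i := by
  have hW : h.length ≤ k * (k + 1) := hh ▸ Nat.mul_le_mul_right _ hi
  rcases (Nat.succ_le_iff.mpr hi).eq_or_lt with hik | hik
  · exact outcome_ne_cand_of_isSettled hσ hleg hW hi (isSettled_of_lt hh hi (by omega))
      (hik ▸ isSettled_self h) hpot.le hother
  have hlen := length_append_replicate hh (cand k (i + 1))
  have hW' : (i + 1 + 1) * (k + 1) ≤ k * (k + 1) := Nat.mul_le_mul_right _ hik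
  have hleg' := legalHistory_append_replicate hleg (i + 1) (r := k + 1)
    (by rw [hh, ← Nat.succ_mul]; exact hW')
  have hpot' (l : ℕ) (hl : l ≤ k) := pot_append_replicate hh hik hl
  have hle (l : ℕ) (hl : l ≤ k + 1) :
      pot (h ++ List.replicate (k + 1) {cand k (i + 1)}) l ≤ pot h l := by
    have := pot_append_replicate_add hh hik le_rfl hl
    omega
  have hne : σ.outcome (h ++ List.replicate (k + 1) {cand k (i + 1)}) ≠ cand k i :=
    outcome_ne_cand_of_isSettled hσ hleg' (hlen ▸ hW') hi (isSettled_of_lt hlen hik (by omega))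
      (isSettled_of_lt hlen hik (by omega)) (by rw [hpot' i hi.le, hpot' (i + 1) hi, hpot])
      fun l hl hli hli' => (hle l hl).trans_lt (hpot' (i + 1) hi ▸ hother l hl hli hli')
  have hmem := outcome_mem_of_append_replicate hσ hleg hh hik <| by
    have hsize := (lt_size_of_le (hlen ▸ hW')).le
    obtain ⟨m, hm, ho⟩ := exists_outcome_eq_cand hσ hleg' hsize
    by_cases hmi : m = i + 1
    · rw [ho, hmi]
      exact Finset.mem_insert_of_mem (Finset.mem_singleton_self _)
    have hmi' : m ≠ i := fun e => hne (e ▸ ho)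
    refine absurd ho (outcome_ne_cand_of_pot_lt hσ hleg' (e := 0) (l := i) hsize (by omega) hm
      hmi'.symm (isSettled_of_lt hlen hik (by omega)) (fun e => absurd e hmi) ?_)
    have := hother m hm hmi' hmi
    have := hle m hm
    rw [hpot' i hi.le]
    omega
  intro ho
  rw [ho, Finset.mem_insert, Finset.mem_singleton, cand_inj (by omega) le_rfl,
    cand_inj (by omega) (by omega)] at hmem
  omega

theorem outcome_ne_cand_of_score_add_score_le (hh : h.length = (i + 1) * (k + 1)) (hi : i < k)
    (hpos : 0 < score h (cand k i))
    (hsum : ∀ l ≤ k, l ≠ i → score h (cand k i) + score h (cand k l) ≤ k + 1)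
    (helect : score h (cand k i) + score h (cand k (k + 1)) ≤ h.length) :
    σ.outcome h ≠ cand k i := by
  have hW : h.length ≤ k * (k + 1) := hh ▸ Nat.mul_le_mul_right _ hi
  have hpast (l : ℕ) (hl : l ≤ i) := pot_add_of_lt hh (by omega : l < i + 1) hi
  have hfuture (l : ℕ) (hl : i < l) (hlk : l ≤ k) := pot_add_of_le hh hl hlk
  have hnext := hfuture (i + 1) (by omega) hi
  have hi' := hpast i le_rfl
  by_cases hsmall : ∀ l ≤ i, pot h l ≤ pot h (i + 1)
  · exact outcome_ne_cand_of_forall_pot_le hσ hleg hh (Nat.lt_succ_self i) hi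
      (Nat.lt_succ_self i) hi hsmall i le_rfl
  push Not at hsmall
  obtain ⟨p, hp, hlt⟩ := hsmall
  rcases hp.lt_or_eq with hpi | rfl
  · have hsp := hsum p (by omega) (by omega)
    have hp' := hpast p hp
    exact outcome_ne_cand_of_pot_lt hσ hleg (e := 1) (l := p) (lt_size_of_le hW).le (by omega)
      (by omega) (by omega) (isSettled_of_lt hh hi (by omega)) (fun _ _ => .inr le_rfl) (by omega)
  · have hsn := hsum (p + 1) hi (by omega)
    refine outcome_ne_cand_of_pot_eq_add_one hσ hleg hh hi (by omega) fun l hl hlp hlp' => ?_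
    rcases hl.eq_or_lt with rfl | hlk
    · have := pot_elect_add hW
      omega
    · have hsl := hsum l (by omega) hlp
      rcases lt_or_gt_of_ne hlp with hlp | hlp
      · have := hpast l hlp.le
        omega
      · have := hfuture l hlp (by omega)
        omega

end Rivals

section OnPath

variable (hσ : (core k).network.IsTruthBiased .plurality σ)

theorem legalHistory_replicate (ht : t ≤ k * (k + 1)) (l : ℕ) :
    rule.LegalHistory (List.replicate t {cand k l}) :=
  legalHistory_append_replicate rule.legalHistory_nil l (by simpa using ht)

theorem pot_replicate_elect (ht : t ≤ k * (k + 1)) :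
    pot (List.replicate t {cand k (k + 1)}) (k + 1) = k * (k + 1) + (k + 4) := by
  have := pot_elect_add (h := List.replicate t {cand k (k + 1)}) (by simpa using ht)
  rw [score_replicate_singleton, if_pos rfl, List.length_replicate] at this
  omega

theorem score_replicate_append (hi : i < k) (hl : l ≤ k + 1) :
    score (List.replicate t {cand k (k + 1)} ++ [{cand k i}]) (cand k l) =
      (if l = k + 1 then t else 0) + if l = i then 1 else 0 := by
  simp only [score_append, score_replicate_singleton, Finset.mem_singleton, cand_inj hl le_rfl,
    cand_inj hl (show i ≤ k + 1 by omega)]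

include hσ

theorem outcome_replicate_append_ne (ht : t < k * (k + 1)) :
    σ.outcome (List.replicate t {cand k (k + 1)} ++ [{cand k (t / (k + 1))}]) ≠
      cand k (t / (k + 1)) := by
  have hi := div_lt_of_lt_mul ht
  have hle : t / (k + 1) * (k + 1) ≤ t := Nat.div_mul_le_self t (k + 1)
  have hlt : t < t / (k + 1) * (k + 1) + (k + 1) := Nat.lt_div_mul_add k.succ_pos
  generalize t / (k + 1) = i at hi hle hlt ⊢
  obtain ⟨m, hm⟩ : ∃ m, i * (k + 1) + (k + 1) = t + 1 + m := Nat.exists_eq_add_of_le hlt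
  have hscore (l : ℕ) (hl : l ≤ k + 1) := score_replicate_append (t := t) hi hl
  have hleg : VotingRule.plurality.LegalHistory
      (List.replicate t {cand k (k + 1)} ++ [({cand k i} : Ballot (core k).numAgents)]) :=
    legalHistory_append_replicate (legalHistory_replicate ht.le _) i (r := 1) (by simpa using ht)
  have hlen : (List.replicate t {cand k (k + 1)} ++
      [({cand k i} : Ballot (core k).numAgents)]).length = t + 1 := by simp
  generalize List.replicate t {cand k (k + 1)} ++
    [({cand k i} : Ballot (core k).numAgents)] = h at *
  have hn : h.length + m ≤ (core k).numAgents := by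
    rw [hlen, ← hm]
    exact block_le_numAgents hi
  have hsum (l : ℕ) (hl : l ≤ k + 1) (hli : l ≠ i) :=
    σ.score_steps_add_score_steps_le hσ.legal hleg hn
      (a := cand k i) (b := cand k l) (by rw [Ne, cand_inj (by omega) hl]; omega)
  rw [← σ.outcome_steps hn]
  refine outcome_ne_cand_of_score_add_score_le hσ (hleg.steps hσ.legal hn)
    (by rw [σ.length_steps, hlen, ← hm, Nat.succ_mul]) hi ?_ (fun l hl hli => ?_) ?_
  · exact (by simp [hscore i (by omega)] : 0 < score h (cand k i)).trans_le
      (σ.score_le_score_steps m h _)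
  · have := hsum l (by omega) hli
    rw [hscore i (by omega), hscore l (by omega)] at this
    split_ifs at this <;> omega
  · have := hsum (k + 1) le_rfl (by omega)
    rw [hscore i (by omega), hscore _ le_rfl] at this
    rw [σ.length_steps, hlen]
    split_ifs at this <;> omega

theorem outcome_replicate_of_eq (ht : t = k * (k + 1)) :
    σ.outcome (List.replicate t {cand k (k + 1)}) = cand k (k + 1) := by
  have hleg := legalHistory_replicate (rule := .plurality) ht.le (k + 1)
  have hlen : (List.replicate t ({cand k (k + 1)} : Ballot (core k).numAgents)).length =
      k * (k + 1) := by rw [List.length_replicate, ht]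
  have hsize := (lt_size_of_le hlen.le).le
  obtain ⟨m, hm, ho⟩ := exists_outcome_eq_cand hσ hleg hsize
  rcases hm.eq_or_lt with rfl | hm
  · exact ho
  refine absurd ho (outcome_ne_cand_of_pot_lt hσ hleg (e := 0) (l := k + 1) hsize le_rfl
    (by omega) hm.ne' (isSettled_of_le hlen.ge) (by omega) ?_)
  have helect := pot_replicate_elect ht.le
  have hscore : score (List.replicate t {cand k (k + 1)}) (cand k m) = 0 := by
    rw [score_replicate_singleton, if_neg (by rw [cand_inj (by omega) le_rfl]; omega)]
  rw [if_pos hm]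
  rcases (Nat.lt_succ_iff.mp hm).eq_or_lt with hmk | hmk
  · have := pot_add_of_le hlen hmk.ge hmk.le
    omega
  · have := pot_add_of_lt hlen hmk le_rfl
    omega

theorem outcome_replicate (ht : t ≤ k * (k + 1)) :
    σ.outcome (List.replicate t {cand k (k + 1)}) = cand k (k + 1) := by
  induction ht using Nat.decreasingInduction with
  | self => exact outcome_replicate_of_eq hσ rfl
  | of_succ t ht ih =>
    have hleg := legalHistory_replicate (rule := .plurality) ht.le (k + 1)
    have hlen : (List.replicate t ({cand k (k + 1)} : Ballot (core k).numAgents)).length = t :=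
      List.length_replicate
    let x : Fin (core k).numAgents :=
      ⟨t, (lt_size_of_le ht.le).trans_le (core k).size_le_numAgents⟩
    refine hσ.outcome_eq_of_out_eq_pair hleg (x := x) hlen (out_eq_pair ht) (fun hself => ?_)
      (by rwa [← List.replicate_succ']) fun B hB hb _ hmem => ?_
    · obtain ⟨m, -, e⟩ := exists_outcome_eq_cand hσ hleg (hlen.trans_le (lt_size_of_le ht.le).le)
      have := congrArg Fin.val (hself.symm.trans e)
      rw [val_cand] at this
      simp only [x] at this
      omega
    obtain rfl : B = {cand k (t / (k + 1))} := Finset.eq_singleton_iff_unique_mem.mpr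
      ⟨hb, fun b hb' => Finset.card_le_one.mp hB.2 b hb' _ hb⟩
    have hdiv := div_lt_of_lt_mul ht
    have hpot := pot_append (h := List.replicate t {cand k (k + 1)}) (hlen.symm ▸ ht)
      {cand k (t / (k + 1))} le_rfl
    rw [pot_replicate_elect ht.le, if_pos (.inl rfl),
      if_neg (by rw [Finset.mem_singleton, cand_inj le_rfl (by omega)]; omega)] at hpot
    rcases Finset.mem_insert.mp hmem with e | e
    · exact outcome_ne_elect hσ (hleg.append (x := x) hlen hB) (by simp; omega) (by omega) e
    · exact outcome_replicate_append_ne hσ ht (Finset.mem_singleton.mp e)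

end OnPath
end Equilibrium

theorem popularity_elect (k : ℕ) :
    (core k).popularity (place k (k + 1)) = k * (k + 1) + (k + 4) := by
  have := likersFrom_elect_add (k := k) (Nat.zero_le _)
  rwa [add_zero, Network.likersFrom_zero, Core.popularity_network (place_lt k _)] at this

theorem popularity_cand_add {l : ℕ} (hl : l ≤ k) :
    (core k).popularity (place k l) + l = k * (k + 1) + (2 * k + 4) := by
  have := pot_add_of_le (h := []) (j := 0) (by simp) (Nat.zero_le _) hl
  rwa [pot, Network.potential, score_nil, zero_add, zero_add, List.length_nil,
    Network.likersFrom_zero, Core.popularity_network (place_lt k _)] at this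

theorem popularity_eq_zero {a : ℕ} (ha : a < k * (k + 1)) : (core k).popularity a = 0 := by
  rw [Core.popularity, Nat.add_eq_zero_iff, Finset.card_eq_zero, Finset.filter_eq_empty_iff]
  refine ⟨fun x _ => ?_, Nat.eq_zero_of_not_pos fun h => (le_of_fans_pos h).not_gt ha⟩
  simp only [core, place]
  split_ifs
  · simp only [Finset.mem_insert, Finset.mem_singleton]
    omega
  · rw [Finset.mem_singleton]
    omega
  · exact Finset.notMem_empty a

theorem card_confirms_le (x : ℕ) : ((core k).confirms x).card ≤ 2 := by
  simp only [core]
  split_ifs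
  · exact Finset.card_le_two
  · simp
  · simp

theorem exists_network (hk : 1 ≤ k) :
    ∃ (n : ℕ) (G : Network n) (w : Fin n), G.maxOut = 2 ∧
      (G.popularity w : ℤ) = (G.maxIn : ℤ) - (k : ℤ) ∧
      ∀ ε : ℝ, 0 < ε → ε < 1 / (2 * (n : ℝ)) →
        G.achievable .plurality ε = {w} ∧ G.additiveGap .plurality ε = (k : ℤ) := by
  have hpos : 0 < k * (k + 1) := by positivity
  have htop := popularity_cand_add (Nat.zero_le k)
  refine (core k).exists_network_of_outcome_eq .plurality (w := place k (k + 1))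
    (top := place k 0) (y := 0) one_le_two (fun x _ => card_confirms_le x) (core k).size_pos
    ?_ (place_lt k _) ?_ (place_lt k _) (fun a ha => ?_) ?_ fun σ hσ => ?_
  · simp only [core, if_pos hpos]
    exact Finset.card_pair (by simp only [place, Nat.zero_div]; omega)
  · simp only [core, place]
    rw [if_neg (by omega), if_neg (by omega)]
  · rcases lt_or_ge a (k * (k + 1)) with haW | haW
    · exact (popularity_eq_zero haW).trans_le (Nat.zero_le _)
    obtain ⟨l, hl, rfl⟩ : ∃ l ≤ k + 1, a = place k l := by
      refine ⟨k * (k + 1) + (k + 1) - a, by omega, ?_⟩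
      simp only [core] at ha
      simp only [place]
      omega
    rcases hl.eq_or_lt with rfl | hl
    · rw [popularity_elect]
      omega
    · have := popularity_cand_add (Nat.lt_succ_iff.mp hl)
      omega
  · rw [popularity_elect]
    omega
  · exact congrArg Fin.val (outcome_replicate hσ (Nat.zero_le _))

end BlockNetwork

theorem exists_network_additiveGap_eq (rule : VotingRule) {k : ℕ} (hk : 1 ≤ k) :
    ∃ (n : ℕ) (G : Network n) (w : Fin n), G.maxOut = 2 ∧
      (G.popularity w : ℤ) = (G.maxIn : ℤ) - (k : ℤ) ∧
      ∀ ε : ℝ, 0 < ε → ε < 1 / (2 * (n : ℝ)) →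
        G.achievable rule ε = {w} ∧ G.additiveGap rule ε = (k : ℤ) := by
  cases rule
  · exact BlockNetwork.exists_network hk
  · exact PairNetwork.exists_network hk

theorem supAdditiveGap_eq_top (rule : VotingRule) {ε : ℕ → ℝ} {𝒢 : ∀ n, Set (Network n)}
    (hgap : ∀ k : ℕ, 1 ≤ k → ∃ n, ∃ G ∈ 𝒢 n, G.additiveGap rule (ε n) = (k : ℤ)) :
    supAdditiveGap rule ε 𝒢 = ⊤ := by
  rw [EReal.eq_top_iff_forall_lt]
  intro y
  obtain ⟨k, hk⟩ := exists_nat_gt y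
  obtain ⟨n, G, hG, he⟩ := hgap (k + 1) (Nat.le_add_left 1 k)
  calc (y : EReal) < ((k + 1 : ℕ) : ℝ) := by
        rw [EReal.coe_lt_coe_iff]
        exact hk.trans (by exact_mod_cast k.lt_succ_self)
    _ = ((G.additiveGap rule (ε n) : ℤ) : ℝ) := by rw [he, Int.cast_natCast]
    _ ≤ supAdditiveGap rule ε 𝒢 := le_iSup_of_le n (le_iSup_of_le G (le_iSup_of_le hG le_rfl))

end SeqVoting

theorem mainTheorem2 (rule : SeqVoting.VotingRule) :
    (∀ ε : ℕ → ℝ, (∀ n : ℕ, 0 < n → 0 < ε n ∧ ε n < 1 / (2 * (n : ℝ))) →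
      SeqVoting.supAdditiveGap rule ε (fun _ => {G | G.maxOut = 2}) = ⊤) ∧
    ∀ k : ℕ, 2 ≤ k →
      ∃ (n : ℕ) (G : SeqVoting.Network n) (w : Fin n),
        G.maxOut = 2 ∧
        (G.popularity w : ℤ) = (G.maxIn : ℤ) - (k : ℤ) ∧
        ∀ ε : ℝ, 0 < ε → ε < 1 / (2 * (n : ℝ)) →
          G.achievable rule ε = {w} ∧ G.additiveGap rule ε = (k : ℤ) := by
  refine ⟨fun ε hε => SeqVoting.supAdditiveGap_eq_top rule fun k hk => ?_,
    fun k hk => SeqVoting.exists_network_additiveGap_eq rule (one_le_two.trans hk)⟩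
  obtain ⟨n, G, w, hout, -, hgap⟩ := SeqVoting.exists_network_additiveGap_eq rule hk
  obtain ⟨hpos, hlt⟩ := hε n w.pos
  exact ⟨n, G, hout, (hgap (ε n) hpos hlt).2⟩
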